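/- Let $d\ge 0$, let $\mathbb T^d=(\mathbb R/\mathbb Z)^d$, let $A\in GL_d(\mathbb Z)$ and let $f=f_A:\mathbb T^d\to\mathbb T^d$, $f(x)=Ax$, be the linear automorphism of the torus defined by $A$. For a self-map $g$ of $\mathbb T^d$ and $S\subset\mathbb T^d$ let $r_g(\varepsilon,n,S)$ be the minimal number of dynamical balls $\{y:\ d(g^jy,g^jx)<\varepsilon,\ 0\le j<n\}$ needed to cover $S$, and put $$h_{\rm top}(g,S)=\lim_{\varepsilon\to0}\limsup_{n\to\infty}\frac1n\log r_g(\varepsilon,n,S),\qquad h_{\rm top}(g)=h_{\rm top}(g,\mathbb T^d).$$ A $C^\infty$ singular $k$-disk is a map $\phi:Q^k=[-1,1]^k\to\mathbb T^d$ that extends to a $C^\infty$ map on a neighborhood of $Q^k$; its $C^\infty$ size is at most $1$ if, at each point of $Q^k$, all its partial derivatives of all orders, in the coordinates of some chart of the finite atlas of $\mathbb T^d$ given by the inverses of the projection $\mathbb R^d\to\mathbb T^d$ on the products of intervals $(-\frac12,\frac12)$ and $(0,1)$, have absolute value at most $1$. Define the $k$-dimensional entropy and the uniform $k$-dimensional entropy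 $$h^k_{\rm top}(g)=\sup_{\phi}h_{\rm top}(g,\phi(Q^k)),\qquad H^k_{\rm top}(g)=\lim_{\varepsilon\to0}\limsup_{n\to\infty}\frac1n\log\sup_{\phi}r_g(\varepsilon,n,\phi(Q^k)),$$ where $\phi$ ranges over all $C^\infty$ singular $k$-disks, respectively over those of $C^\infty$ size at most $1$. Put $d_u(g)=\min\{0\le k\le d: H^k_{\rm top}(g)=h_{\rm top}(g)\}$ and, for a homeomorphism $g$, $d_s(g)=d_u(g^{-1})$. Then the following are equivalent: 1. $f$ is entropy-hyperbolic, i.e. $d_u(f)$ and $d_s(f)$ are defined (the minima are over nonempty sets) and $d_u(f)+d_s(f)=d$; 2. $f$ is entropy-hyperbolic in terms of the non-uniform dimensional entropies, i.e. there are integers $u,s\ge0$ with $u+s=d$ such that $h^{u}_{\rm top}(f)=h_{\rm top}(f)$ and this fails for every dimension $k<u$, and $h^{s}_{\rm top}(f^{-1})=h_{\rm top}(f)$ and $h^{k}_{\rm top}(f^{-1})\neq h_{\rm top}(f)$ for every $k<s$; 3. $f$ is hyperbolic, i.e. no complex eigenvalue of $A$ has absolute value $1$. -/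

import Mathlib

open Filter Topology Uniformity Dynamics

noncomputable section

namespace DimEntropy

/-! ### Entropy of collections of subsets

Mathlib's `Dynamics.coverEntropy f S` is the Bowen-Dinaburg entropy
`lim_{ε → 0} limsup_n (1/n) log r_f(ε, n, S)`, and `Dynamics.coverMincard f S V n` is the covering
number `r_f(V, n, S)` of `S` by the dynamical balls of the entourage `V`. -/

section Families

variable {X : Type*} [UniformSpace X]

/-- Topological entropy `h_top(f)`. -/
def topEntropy (f : X → X) : EReal := coverEntropy f Set.univ

/-- Topological entropy of a collection `𝒟` of subsets: `sup_{D ∈ 𝒟} h_top(f, D)`. -/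
def familyEntropy (f : X → X) (𝒟 : Set (Set X)) : EReal :=
  ⨆ D ∈ 𝒟, coverEntropy f D

/-- Uniform topological entropy of a collection `𝒟` of subsets:
`lim_{ε → 0} limsup_n (1/n) log sup_{D ∈ 𝒟} r_f(ε, n, D)`. -/
def uniformFamilyEntropy (f : X → X) (𝒟 : Set (Set X)) : EReal :=
  ⨆ V ∈ 𝓤 X, ExpGrowth.expGrowthSup
    fun n : ℕ => ⨆ D ∈ 𝒟, ((coverMincard f D V n : ℕ∞) : ENNReal)

end Families

/-! ### The torus and its singular disks -/

/-- The torus `𝕋^d = (ℝ/ℤ)^d`. -/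
abbrev Torus (d : ℕ) : Type := Fin d → UnitAddCircle

/-- The projection `ℝ^d → 𝕋^d`. -/
def toTorus {d : ℕ} (x : Fin d → ℝ) : Torus d := fun i => (x i : UnitAddCircle)

/-- The cube `Q^k = [-1,1]^k`. -/
def cube (k : ℕ) : Set (Fin k → ℝ) := Set.Icc (fun _ => -1) (fun _ => 1)

/-- `g` is a `C^r` local lift of `φ` to `ℝ^d` near `t`. The smooth structure of `𝕋^d` is the one
whose charts are the local inverses of `ℝ^d → 𝕋^d`, so `g` is `φ` read in such a chart. -/
def IsLocalLift {k d : ℕ} (r : ℕ∞) (φ : (Fin k → ℝ) → Torus d) (t : Fin k → ℝ)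
    (g : (Fin k → ℝ) → Fin d → ℝ) : Prop :=
  ContDiffAt ℝ r g t ∧ φ =ᶠ[𝓝 t] fun s => toTorus (g s)

/-- `φ` represents a `C^r` singular `k`-disk: it is of class `C^r` on a neighbourhood of `Q^k`.
(Its values away from `Q^k` play no role.) -/
def IsDisk {k d : ℕ} (r : ℕ∞) (φ : (Fin k → ℝ) → Torus d) : Prop :=
  ∃ U : Set (Fin k → ℝ), IsOpen U ∧ cube k ⊆ U ∧ ∀ t ∈ U, ∃ g, IsLocalLift r φ t g

/-- The `C^r` size of `φ` is at most `C`: at every `t ∈ Q^k`, all partial derivatives of order at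
most `r` of all coordinates of `φ`, read in some chart around `φ t`, are at most `C` in absolute
value. The finite atlas used to measure sizes consists of the `2^d` inverses of the projection
`ℝ^d → 𝕋^d` on the cubes that are products of the intervals `(-1/2, 1/2)` and `(0, 1)`; a point
of `ℝ^d` lies in one of these cubes if and only if its coordinates are in `(-1/2, 1)`. -/
def SizeLE {k d : ℕ} (r : ℕ∞) (φ : (Fin k → ℝ) → Torus d) (C : ℝ) : Prop :=
  ∀ t ∈ cube k, ∃ g, IsLocalLift r φ t g ∧ (∀ j, g t j ∈ Set.Ioo (-1 / 2 : ℝ) 1) ∧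
    ∀ m : ℕ, (m : ℕ∞) ≤ r → ∀ (v : Fin m → Fin k) (j : Fin d),
      |iteratedFDeriv ℝ m g t (fun i => Pi.single (v i) 1) j| ≤ C

/-- The standard family of `C^r` singular `k`-disks (as subsets of the torus). -/
def diskFamily (d k : ℕ) (r : ℕ∞) : Set (Set (Torus d)) :=
  {D | ∃ φ : (Fin k → ℝ) → Torus d, IsDisk r φ ∧ D = φ '' cube k}

/-- The standard uniform family: the `C^r` singular `k`-disks with `C^r` size at most `1`. -/
def uniformDiskFamily (d k : ℕ) (r : ℕ∞) : Set (Set (Torus d)) :=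
  {D | ∃ φ : (Fin k → ℝ) → Torus d, IsDisk r φ ∧ SizeLE r φ 1 ∧ D = φ '' cube k}

/-! ### Dimensional entropies and entropy-hyperbolicity -/

/-- The `k`-dimensional entropy `h^k_top(f)`, computed with `C^∞` disks. -/
def dimEntropy {d : ℕ} (k : ℕ) (f : Torus d → Torus d) : EReal :=
  familyEntropy f (diskFamily d k ⊤)

/-- The `k`-dimensional uniform entropy `H^k_top(f)`, computed with the `C^∞` disks of `C^∞` size
at most `1`. -/
def uniformDimEntropy {d : ℕ} (k : ℕ) (f : Torus d → Torus d) : EReal :=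
  uniformFamilyEntropy f (uniformDiskFamily d k ⊤)

/-- `u` is the unstable dimension of `f`: the least `0 ≤ k ≤ d` with `H^k_top(f) = h_top(f)`. -/
def IsUnstableDim {d : ℕ} (f : Torus d → Torus d) (u : ℕ) : Prop :=
  IsLeast {k : ℕ | k ≤ d ∧ uniformDimEntropy k f = topEntropy f} u

/-- Entropy-hyperbolicity in terms of the unstable and stable dimensions (defined by the uniform
dimensional entropies of `f` and `f⁻¹`): `d_u(f) + d_s(f) = d` with `d_s(f) = d_u(f⁻¹)`. -/
def EntropyHyperbolic {d : ℕ} (f : Torus d ≃ₜ Torus d) : Prop :=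
  ∃ u s : ℕ, IsUnstableDim f u ∧ IsUnstableDim f.symm s ∧ u + s = d

/-- Entropy-hyperbolicity in terms of the (non-uniform) dimensional entropies: there are `u, s`
with `u + s = d` such that `h^u_top(f) = h_top(f)` and this fails in dimensions `k < u`, and
`h^s_top(f⁻¹) = h_top(f)` and this fails in dimensions `k < s`. -/
def EntropyHyperbolic' {d : ℕ} (f : Torus d ≃ₜ Torus d) : Prop :=
  ∃ u s : ℕ,
    (dimEntropy u f = topEntropy f ∧ ∀ k < u, dimEntropy k f ≠ topEntropy f) ∧
    (dimEntropy s f.symm = topEntropy f ∧ ∀ k < s, dimEntropy k f.symm ≠ topEntropy f) ∧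
    u + s = d

/-! ### Linear automorphisms of the torus -/

/-- The self-map `x ↦ A x` of the torus defined by an integer matrix. -/
def matrixMap {d : ℕ} (A : Matrix (Fin d) (Fin d) ℤ) (x : Torus d) : Torus d :=
  fun i => ∑ j, A i j • x j

theorem matrixMap_mul {d : ℕ} (A B : Matrix (Fin d) (Fin d) ℤ) (x : Torus d) :
    matrixMap (A * B) x = matrixMap A (matrixMap B x) := by
  funext i
  simp only [matrixMap, Matrix.mul_apply, Finset.sum_smul, Finset.smul_sum, smul_smul]
  exact Finset.sum_comm

theorem matrixMap_one {d : ℕ} (x : Torus d) :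
    matrixMap (1 : Matrix (Fin d) (Fin d) ℤ) x = x := by
  funext i
  simp [matrixMap, Matrix.one_apply]

theorem continuous_matrixMap {d : ℕ} (A : Matrix (Fin d) (Fin d) ℤ) :
    Continuous (matrixMap A) := by
  unfold matrixMap
  fun_prop

/-- The linear automorphism of the torus defined by `A ∈ GL_d(ℤ)`. -/
def linearAut {d : ℕ} (A : Matrix.GeneralLinearGroup (Fin d) ℤ) : Torus d ≃ₜ Torus d where
  toFun := matrixMap A.val
  invFun := matrixMap (A⁻¹).val
  left_inv x := by rw [← matrixMap_mul, ← Units.val_mul, inv_mul_cancel, Units.val_one,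
    matrixMap_one]
  right_inv x := by rw [← matrixMap_mul, ← Units.val_mul, mul_inv_cancel, Units.val_one,
    matrixMap_one]
  continuous_toFun := continuous_matrixMap _
  continuous_invFun := continuous_matrixMap _

/-- No complex eigenvalue of `A` lies on the unit circle. -/
def IsHyperbolic {d : ℕ} (A : Matrix.GeneralLinearGroup (Fin d) ℤ) : Prop :=
  ∀ μ : ℂ, Module.End.HasEigenvalue (Matrix.toLin' (A.val.map (Int.cast : ℤ → ℂ))) μ → ‖μ‖ ≠ 1

end DimEntropy

end

/-! Let `P` be the spectral projection of `A` onto the sum `E` of its generalized eigenspaces with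
eigenvalues of modulus greater than 1, let `u` be its rank and `D = |det (A|E)|`. The crux is that
`u` is exactly the dimension at which both dimensional entropies reach `h_top`. All the bounds
compare volumes of boxes in the universal cover: up to factors `θ ^ (d n)` with `θ < 1` arbitrarily
close to 1, a dynamical ball of length `n` has volume `D⁻ⁿ`, because distances grow subexponentially
on the kernel of `P`.

Upper bound (`topEntropy_le`): disjoint dynamical balls number at most about `Dⁿ`. Lower bound
(`le_coverEntropy_unstableDisk`): a cover of a small linear disk in `E` also covers, at twice the
scale, its thickening by `θⁿ` along the kernel, so it needs about `Dⁿ` balls. Hence `h_top = log D`,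
and it is attained in dimension `u`, even by a disk of size at most 1.

Below dimension `u` there is a definite loss (`uniformFamilyEntropy_lt`). If `A⁻¹` contracts `E` at
rate `ρ < 1`, dynamical balls have unstable width of order at most `ρⁿ`. A Lipschitz `k`-disk meets
about `ρ^(-kn)` cubes of that side, so all the dynamical balls centred on it fill a volume of order
at most `ρ^((u-k)n)`, and their number grows at rate at most `ρ^(u-k) D < D`. The rate is
independent of the Lipschitz constant, so the loss survives the supremum over all disks.

The same holds for `A⁻¹`, whose entropy is the same, with the stable dimension `s`. As `u + s + c =
d`, where `c` is the dimension of the central part, `u + s = d` says that there is no eigenvalue of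
modulus 1. -/

noncomputable section

namespace DimEntropy

open scoped Matrix.Norms.Operator

/-! ### Growth of powers from annihilating polynomials -/

/-- A sequence with `u (n+1) ≤ w u n + K ρ^n` and `w < ρ` is `O(ρ^n)`. -/
theorem exists_le_mul_pow_of_recurrence {u : ℕ → ℝ} {w ρ K : ℝ} (hw : 0 ≤ w) (hwρ : w < ρ)
    (h : ∀ n, u (n + 1) ≤ w * u n + K * ρ ^ n) : ∃ C, ∀ n, u n ≤ C * ρ ^ n := by
  have hρ : 0 < ρ := hw.trans_lt hwρ
  refine ⟨max (u 0) (K / (ρ - w)), fun n => ?_⟩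
  induction n with
  | zero => simp
  | succ n ih =>
    set C := max (u 0) (K / (ρ - w))
    have hK : K ≤ C * (ρ - w) := by
      rw [← div_le_iff₀ (sub_pos.2 hwρ)]; exact le_max_right _ _
    have hpow : 0 < ρ ^ n := pow_pos hρ n
    calc u (n + 1) ≤ w * u n + K * ρ ^ n := h n
      _ ≤ w * (C * ρ ^ n) + C * (ρ - w) * ρ ^ n := by gcongr
      _ = C * ρ ^ (n + 1) := by ring

section Growth

open Polynomial

variable {R : Type*} [NormedRing R] [NormedAlgebra ℂ R]

/-- Peeling off one root `z` replaces Jordan forms: `a^(n+1) x = z a^n x + a^n (a - z) x`, and `(a -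
z) x` is killed by the remaining factors. The strict inequality `‖z‖ < ρ` absorbs the polynomial
factors caused by multiple roots. -/
theorem exists_norm_pow_mul_le {a x : R} {ρ : ℝ} {s : Multiset ℂ} (hs : ∀ z ∈ s, ‖z‖ < ρ)
    (h : aeval a (s.map fun z => X - C z).prod * x = 0) :
    ∃ K, ∀ n, ‖a ^ n * x‖ ≤ K * ρ ^ n := by
  induction s using Multiset.induction_on generalizing x with
  | empty => exact ⟨0, fun n => by simp_all⟩
  | cons z s ih =>
    obtain ⟨K, hK⟩ := ih (x := (a - algebraMap ℂ R z) * x)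
      (fun w hw => hs w (Multiset.mem_cons_of_mem hw)) (by
        rw [← mul_assoc, ← h, Multiset.map_cons, Multiset.prod_cons, mul_comm (X - C z), map_mul]
        simp)
    refine exists_le_mul_pow_of_recurrence (w := ‖z‖) (K := K) (norm_nonneg _)
      (hs z (Multiset.mem_cons_self _ _)) fun n => ?_
    have : a ^ (n + 1) * x = z • (a ^ n * x) + a ^ n * ((a - algebraMap ℂ R z) * x) := by
      rw [sub_mul, mul_sub, ← mul_assoc, ← pow_succ, Algebra.algebraMap_eq_smul_one,
        smul_mul_assoc, one_mul, mul_smul_comm]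
      abel
    rw [this]
    exact (norm_add_le _ _).trans (add_le_add (norm_smul_le _ _) (hK n))

/-- The same peeling for negative powers, after solving the recurrence for `b^(n+1) x`, which costs
a division by `z`. -/
theorem exists_norm_inv_pow_mul_le {a b x : R} {ρ : ℝ} (hba : b * a = 1)
    {s : Multiset ℂ} (hs0 : ∀ z ∈ s, z ≠ 0) (hs : ∀ z ∈ s, ‖z‖⁻¹ < ρ)
    (h : aeval a (s.map fun z => X - C z).prod * x = 0) :
    ∃ K, ∀ n, ‖b ^ n * x‖ ≤ K * ρ ^ n := by
  induction s using Multiset.induction_on generalizing x with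
  | empty => exact ⟨0, fun n => by simp_all⟩
  | cons z s ih =>
    obtain ⟨K, hK⟩ := ih (x := (a - algebraMap ℂ R z) * x)
      (fun w hw => hs0 w (Multiset.mem_cons_of_mem hw))
      (fun w hw => hs w (Multiset.mem_cons_of_mem hw)) (by
        rw [← mul_assoc, ← h, Multiset.map_cons, Multiset.prod_cons, mul_comm (X - C z), map_mul]
        simp)
    have hz := hs0 z (Multiset.mem_cons_self _ _)
    refine exists_le_mul_pow_of_recurrence (w := ‖z‖⁻¹) (K := ‖z‖⁻¹ * (K * ρ)) (by positivity)
      (hs z (Multiset.mem_cons_self _ _)) fun n => ?_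
    have : b ^ (n + 1) * x =
        z⁻¹ • (b ^ n * x) - z⁻¹ • (b ^ (n + 1) * ((a - algebraMap ℂ R z) * x)) := by
      have h1 : b ^ (n + 1) * (a * x) = b ^ n * x := by
        rw [pow_succ, mul_assoc, ← mul_assoc b a, hba, one_mul]
      rw [sub_mul, mul_sub, h1, Algebra.algebraMap_eq_smul_one,
        smul_mul_assoc, one_mul, mul_smul_comm, smul_sub, smul_smul, inv_mul_cancel₀ hz, one_smul]
      abel
    rw [this]
    refine (norm_sub_le _ _).trans (add_le_add ?_ ?_)
    · rw [← norm_inv]; exact norm_smul_le _ _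
    · refine (norm_smul_le _ _).trans ?_
      rw [norm_inv, mul_assoc, mul_assoc, ← pow_succ']
      gcongr
      exact hK _

end Growth

/-! ### Spectral projections of real matrices -/

section Projection

open Polynomial ComplexConjugate

/-- A complex polynomial invariant under conjugation of its coefficients is real. -/
theorem exists_real_polynomial {p : ℂ[X]} (hp : p.map (starRingEnd ℂ) = p) :
    ∃ q : ℝ[X], q.map (algebraMap ℝ ℂ) = p := by
  rw [← mem_lifts, lifts_iff_coeff_lifts]
  intro n
  have := congrArg (fun q => coeff q n) hp
  simp only [coeff_map] at this
  obtain ⟨r, hr⟩ := Complex.conj_eq_iff_real.1 this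
  exact ⟨r, hr.symm⟩

/-- The monic polynomial whose roots are the roots of `p` that satisfy `T`. -/
def rootFactor (p : ℂ[X]) (T : ℂ → Prop) [DecidablePred T] : ℂ[X] :=
  ((p.roots.filter T).map fun z => X - C z).prod

theorem rootFactor_mul (p : ℂ[X]) (hp : p.Monic) (T : ℂ → Prop) [DecidablePred T] :
    rootFactor p T * rootFactor p (fun z => ¬ T z) = p := by
  rw [rootFactor, rootFactor, ← Multiset.prod_add, ← Multiset.map_add, Multiset.filter_add_not]
  exact ((IsAlgClosed.splits p).eq_prod_roots_of_monic hp).symm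

/-- Conjugation permutes the roots of a real polynomial, with multiplicity, and preserves `T`. -/
theorem exists_real_rootFactor (p : ℝ[X]) (T : ℂ → Prop) [DecidablePred T]
    (hT : ∀ z, T (conj z) ↔ T z) :
    ∃ q : ℝ[X], q.map (algebraMap ℝ ℂ) = rootFactor (p.map (algebraMap ℝ ℂ)) T := by
  apply exists_real_polynomial
  set P := p.map (algebraMap ℝ ℂ) with hP
  have hroots : P.roots.map (starRingEnd ℂ) = P.roots := by
    rw [← (IsAlgClosed.splits P).roots_map, hP, Polynomial.map_map]
    congr 2
    ext x
    exact Complex.conj_ofReal x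
  have hfilter : (P.roots.filter T).map (starRingEnd ℂ) = P.roots.filter T := by
    conv_rhs => rw [← hroots, Multiset.filter_map]
    congr 1
    exact Multiset.filter_congr fun z _ => (hT z).symm
  rw [rootFactor, Polynomial.map_multiset_prod, Multiset.map_map]
  conv_rhs => rw [← hfilter, Multiset.map_map]
  simp

theorem isCoprime_multiset_prod {R : Type*} [CommSemiring R] {a : R} (s : Multiset R)
    (h : ∀ b ∈ s, IsCoprime b a) : IsCoprime s.prod a := by
  induction s using Multiset.induction_on with
  | empty => simpa using isCoprime_one_left
  | cons b s ih =>
    rw [Multiset.prod_cons]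
    exact (h b (Multiset.mem_cons_self _ _)).mul_left
      (ih fun c hc => h c (Multiset.mem_cons_of_mem hc))

theorem isCoprime_rootFactor (p : ℂ[X]) (T : ℂ → Prop) [DecidablePred T] :
    IsCoprime (rootFactor p T) (rootFactor p fun z => ¬ T z) := by
  refine isCoprime_multiset_prod _ fun q hq => (isCoprime_multiset_prod _ fun r hr => ?_).symm
  obtain ⟨z, hz, rfl⟩ := Multiset.mem_map.1 hq
  obtain ⟨w, hw, rfl⟩ := Multiset.mem_map.1 hr
  refine IsCoprime.symm ?_
  refine isCoprime_X_sub_C_of_isUnit_sub (sub_ne_zero.2 ?_).isUnit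
  rintro rfl
  exact (Multiset.mem_filter.1 hw).2 (Multiset.mem_filter.1 hz).2

variable {d : ℕ}

/-- The complexification of a real matrix. -/
abbrev complexify : Matrix (Fin d) (Fin d) ℝ →ₐ[ℝ] Matrix (Fin d) (Fin d) ℂ :=
  Complex.ofRealAm.mapMatrix

theorem norm_complexify (M : Matrix (Fin d) (Fin d) ℝ) : ‖complexify M‖ = ‖M‖ := by
  simp [Matrix.linfty_opNorm_def]

theorem complexify_aeval (M : Matrix (Fin d) (Fin d) ℝ) (q : ℝ[X]) :
    complexify (aeval M q) = aeval (complexify M) (q.map (algebraMap ℝ ℂ)) := by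
  rw [← Polynomial.aeval_algHom_apply, aeval_map_algebraMap]

/-- The characteristic polynomial over `ℂ`. -/
abbrev complexCharpoly (M : Matrix (Fin d) (Fin d) ℝ) : ℂ[X] := M.charpoly.map (algebraMap ℝ ℂ)

theorem exists_spectral_projection (M : Matrix (Fin d) (Fin d) ℝ) (T : ℂ → Prop) [DecidablePred T]
    (hT : ∀ z, T (conj z) ↔ T z) :
    ∃ P : Matrix (Fin d) (Fin d) ℝ, P * P = P ∧ (∃ q : ℝ[X], P = aeval M q) ∧
      aeval (complexify M) (rootFactor (complexCharpoly M) T) * complexify P = 0 ∧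
      aeval (complexify M) (rootFactor (complexCharpoly M) fun z => ¬ T z) *
        complexify (1 - P) = 0 := by
  obtain ⟨q₁, h₁⟩ := exists_real_rootFactor M.charpoly T hT
  obtain ⟨q₂, h₂⟩ := exists_real_rootFactor M.charpoly (fun z => ¬ T z) (fun z => not_congr (hT z))
  have hmul : q₁ * q₂ = M.charpoly := by
    apply Polynomial.map_injective (algebraMap ℝ ℂ) (algebraMap ℝ ℂ).injective
    rw [Polynomial.map_mul, h₁, h₂, rootFactor_mul _ (M.charpoly_monic.map _)]
  have hcop : IsCoprime q₁ q₂ := by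
    rw [← isCoprime_map (algebraMap ℝ ℂ), h₁, h₂]
    exact isCoprime_rootFactor _ T
  obtain ⟨a, b, hab⟩ := hcop
  have hzero : aeval M q₁ * aeval M q₂ = 0 := by
    rw [← map_mul, hmul, Matrix.aeval_self_charpoly]
  have hcompl : 1 - aeval M (b * q₂) = aeval M (a * q₁) := by
    rw [sub_eq_iff_eq_add, ← map_add, hab, map_one]
  -- With `a q₁ + b q₂ = 1`, the complementary projection is `(a q₁)(M)`. Everything then follows
  -- from `(q₁ q₂)(M) = 0`, which is Cayley–Hamilton.
  refine ⟨aeval M (b * q₂), ?_, ⟨_, rfl⟩, ?_, ?_⟩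
  · have : aeval M (a * q₁) * aeval M (b * q₂) = 0 := by
      rw [← map_mul, show a * q₁ * (b * q₂) = a * b * (q₁ * q₂) by ring, map_mul, map_mul _ q₁,
        hzero, mul_zero]
    rwa [← hcompl, sub_mul, one_mul, sub_eq_zero, eq_comm] at this
  · rw [← h₁, ← complexify_aeval, ← map_mul, ← map_mul, show q₁ * (b * q₂) = b * (q₁ * q₂) by ring,
      map_mul, map_mul _ q₁, hzero, mul_zero, map_zero]
  · rw [hcompl, ← h₂, ← complexify_aeval, ← map_mul, ← map_mul,
      show q₂ * (a * q₁) = a * (q₁ * q₂) by ring, map_mul, map_mul _ q₁, hzero, mul_zero, map_zero]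

end Projection

variable {d : ℕ}

/-! ### Unstable splittings -/

/-- `P` is a projection commuting with `A`, whose range is uniformly expanded by `A` and on whose
kernel the powers of `A` grow subexponentially; `A'` is the inverse of `A`. -/
structure UnstableSplitting (A A' P : Matrix (Fin d) (Fin d) ℝ) : Prop where
  inv_mul : A' * A = 1
  idem : P * P = P
  comm : ∀ X, A * X = X * A → P * X = X * P
  expand : ∃ K ρ : ℝ, 0 < ρ ∧ ρ < 1 ∧ ∀ n : ℕ, ‖A' ^ n * P‖ ≤ K * ρ ^ n
  slow : ∀ θ : ℝ, 1 < θ → ∃ K : ℝ, ∀ n : ℕ, ‖A ^ n * (1 - P)‖ ≤ K * θ ^ n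

theorem eq_zero_of_forall_norm_le_mul_pow {E : Type*} [NormedAddCommGroup E] {x : E} {K σ : ℝ}
    (hσ0 : 0 ≤ σ) (hσ1 : σ < 1) (h : ∀ n : ℕ, ‖x‖ ≤ K * σ ^ n) : x = 0 := by
  have ht : Tendsto (fun n : ℕ => K * σ ^ n) atTop (𝓝 (K * 0)) :=
    (tendsto_pow_atTop_nhds_zero_of_lt_one hσ0 hσ1).const_mul K
  rw [mul_zero] at ht
  exact norm_le_zero_iff.1 (ge_of_tendsto' ht h)

theorem exists_pos_lt_one_forall_lt (s : Multiset ℝ) (hs : ∀ r ∈ s, r < 1) :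
    ∃ ρ : ℝ, 0 < ρ ∧ ρ < 1 ∧ ∀ r ∈ s, r < ρ := by
  induction s using Multiset.induction_on with
  | empty => exact ⟨1 / 2, by norm_num, by norm_num, by simp⟩
  | cons a s ih =>
    obtain ⟨ρ, h0, h1, h⟩ := ih fun r hr => hs r (Multiset.mem_cons_of_mem hr)
    obtain ⟨b, hb, hb1⟩ := exists_between (max_lt h1 (hs a (Multiset.mem_cons_self _ _)))
    refine ⟨b, h0.trans ((le_max_left _ _).trans_lt hb), hb1, fun r hr => ?_⟩
    rcases Multiset.mem_cons.1 hr with rfl | hr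
    · exact (le_max_right _ _).trans_lt hb
    · exact (h r hr).trans ((le_max_left _ _).trans_lt hb)

/-! ### Decay rates from the moduli of the roots. -/

section

open Polynomial

theorem norm_pow_mul_le_of_complexify {M X : Matrix (Fin d) (Fin d) ℝ} {K ρ : ℝ}
    (h : ∀ n : ℕ, ‖complexify M ^ n * complexify X‖ ≤ K * ρ ^ n) (n : ℕ) :
    ‖M ^ n * X‖ ≤ K * ρ ^ n := by
  rw [← norm_complexify, map_mul, map_pow]; exact h n

theorem exists_decay_of_roots {A N : Matrix (Fin d) (Fin d) ℝ} {s : Multiset ℂ}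
    (hs : ∀ z ∈ s, ‖z‖ < 1)
    (h : aeval (complexify A) (s.map fun z => X - C z).prod * complexify N = 0) :
    ∃ K ρ : ℝ, 0 < ρ ∧ ρ < 1 ∧ ∀ n : ℕ, ‖A ^ n * N‖ ≤ K * ρ ^ n := by
  obtain ⟨ρ, h0, h1, hρ⟩ := exists_pos_lt_one_forall_lt (s.map fun z => ‖z‖) (by simpa using hs)
  obtain ⟨K, hK⟩ := exists_norm_pow_mul_le (ρ := ρ)
    (fun z hz => hρ _ (Multiset.mem_map_of_mem _ hz)) h
  exact ⟨K, ρ, h0, h1, norm_pow_mul_le_of_complexify hK⟩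

theorem exists_inv_decay_of_roots {A A' N : Matrix (Fin d) (Fin d) ℝ} (hA : A' * A = 1)
    {s : Multiset ℂ} (hs : ∀ z ∈ s, 1 < ‖z‖)
    (h : aeval (complexify A) (s.map fun z => X - C z).prod * complexify N = 0) :
    ∃ K ρ : ℝ, 0 < ρ ∧ ρ < 1 ∧ ∀ n : ℕ, ‖A' ^ n * N‖ ≤ K * ρ ^ n := by
  obtain ⟨ρ, h0, h1, hρ⟩ := exists_pos_lt_one_forall_lt (s.map fun z => ‖z‖⁻¹) (by
    intro r hr
    obtain ⟨z, hz, rfl⟩ := Multiset.mem_map.1 hr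
    exact inv_lt_one_of_one_lt₀ (hs z hz))
  obtain ⟨K, hK⟩ := exists_norm_inv_pow_mul_le (ρ := ρ) (b := complexify A')
    (by rw [← map_mul, hA, map_one])
    (fun z hz => norm_pos_iff.1 (zero_lt_one.trans (hs z hz)))
    (fun z hz => hρ _ (Multiset.mem_map_of_mem (fun z : ℂ => ‖z‖⁻¹) hz)) h
  exact ⟨K, ρ, h0, h1, norm_pow_mul_le_of_complexify hK⟩

/-- `P P' = (A'ⁿ P)(Aⁿ P')` for every `n`, and both factors decay exponentially. -/
theorem UnstableSplitting.mul_eq_zero {A A' P P' : Matrix (Fin d) (Fin d) ℝ}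
    (h : UnstableSplitting A A' P) (h' : UnstableSplitting A' A P') : P * P' = 0 := by
  obtain ⟨K, ρ, h0, h1, hK⟩ := h.expand
  obtain ⟨K', ρ', h0', h1', hK'⟩ := h'.expand
  refine eq_zero_of_forall_norm_le_mul_pow (K := K * K') (σ := ρ * ρ') (by positivity)
    (mul_lt_one_of_nonneg_of_lt_one_left h0.le h1 h1'.le) fun n => ?_
  have hcomm : Commute A A' := h'.inv_mul.trans h.inv_mul.symm
  have hP : P * A ^ n = A ^ n * P := h.comm _ (Commute.self_pow A n)
  have : P * P' = A' ^ n * P * (A ^ n * P') := by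
    rw [mul_assoc, ← mul_assoc P, hP, mul_assoc (A ^ n), ← mul_assoc (A' ^ n),
      ← hcomm.symm.mul_pow, h.inv_mul, one_pow, one_mul]
  rw [this]
  calc _ ≤ ‖A' ^ n * P‖ * ‖A ^ n * P'‖ := norm_mul_le _ _
    _ ≤ (K * ρ ^ n) * (K' * ρ' ^ n) :=
      mul_le_mul (hK n) (hK' n) (norm_nonneg _) ((norm_nonneg _).trans (hK n))
    _ = _ := by rw [mul_pow]; ring

/-- Unstable splittings of `A` and of its inverse exist, and they are complementary if and only if
`A` has no eigenvalue on the unit circle. -/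
theorem exists_unstableSplittings {A A' : Matrix (Fin d) (Fin d) ℝ} (hA : A' * A = 1) :
    ∃ P P', UnstableSplitting A A' P ∧ UnstableSplitting A' A P' ∧
      (1 - P - P' = 0 ↔ ∀ z ∈ (complexCharpoly A).roots, ‖z‖ ≠ 1) := by
  classical
  have hA' : A * A' = 1 := mul_eq_one_comm.1 hA
  have hcomm : Commute A A' := hA'.trans hA.symm
  obtain ⟨P, hPi, ⟨q, hq⟩, hP, hP1⟩ := exists_spectral_projection A (fun z => 1 < ‖z‖) (by simp)
  obtain ⟨P', hPi', ⟨q', hq'⟩, hP', hP1'⟩ :=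
    exists_spectral_projection A (fun z => ‖z‖ < 1) (by simp)
  have hc (q : ℝ[X]) (X) (hX : A * X = X * A) : aeval A q * X = X * aeval A q := by
    have : Commute X (aeval A q) := by
      induction q using Polynomial.induction_on' with
      | add p q hp hq => rw [map_add]; exact hp.add_right hq
      | monomial n a =>
        rw [aeval_monomial]
        exact Commute.mul_right (Algebra.commutes a X).symm (Commute.pow_right hX.symm n)
    exact this.symm.eq
  have hswap (X) (hX : A' * X = X * A') : A * X = X * A := by
    calc A * X = A * (X * A') * A := by rw [mul_assoc, mul_assoc X, hA, mul_one]
      _ = X * A := by rw [← hX, ← mul_assoc A, hA', one_mul]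
  have hu : UnstableSplitting A A' P :=
    { inv_mul := hA
      idem := hPi
      comm := fun X hX => by rw [hq]; exact hc q X hX
      expand := exists_inv_decay_of_roots hA
        (fun z hz => (Multiset.mem_filter.1 hz).2) hP
      slow := fun θ hθ => by
        obtain ⟨K, hK⟩ := exists_norm_pow_mul_le (ρ := θ) (fun z hz =>
          (not_lt.1 (Multiset.mem_filter.1 hz).2).trans_lt hθ) hP1
        exact ⟨K, norm_pow_mul_le_of_complexify hK⟩ }
  have hs : UnstableSplitting A' A P' :=
    { inv_mul := hA'
      idem := hPi'
      comm := fun X hX => by rw [hq']; exact hc q' X (hswap X hX)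
      expand := exists_decay_of_roots (fun z hz => (Multiset.mem_filter.1 hz).2) hP'
      slow := fun θ hθ => by
        obtain ⟨K, hK⟩ := exists_norm_inv_pow_mul_le (ρ := θ) (b := complexify A')
          (by rw [← map_mul, hA, map_one])
          (fun z hz => norm_pos_iff.1
            (zero_lt_one.trans_le (not_lt.1 (Multiset.mem_filter.1 hz).2)))
          (fun z hz =>
            (inv_le_one_of_one_le₀ (not_lt.1 (Multiset.mem_filter.1 hz).2)).trans_lt hθ) hP1'
        exact ⟨K, norm_pow_mul_le_of_complexify hK⟩ }
  refine ⟨P, P', hu, hs, ?_, ?_⟩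
  · intro h0 z hz hz1
    have hroot : (complexify A).charpoly.IsRoot z := by
      have := (Polynomial.mem_roots'.1 hz).2
      rwa [show (complexify A).charpoly = complexCharpoly A from
        Matrix.charpoly_map A (algebraMap ℝ ℂ)]
    have heig : Module.End.HasEigenvalue (Matrix.toLin' (complexify A)) z := by
      rw [Module.End.hasEigenvalue_iff_isRoot_charpoly, Matrix.charpoly_toLin']
      exact hroot
    obtain ⟨w, hw⟩ := heig.exists_hasEigenvector
    have hw1 : (complexify A).mulVec w = z • w := by simpa using hw.apply_eq_smul
    have hz0 : z ≠ 0 := norm_pos_iff.1 (by rw [hz1]; exact one_pos)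
    have hw2 : (complexify A').mulVec w = z⁻¹ • w := by
      have : (complexify A').mulVec ((complexify A).mulVec w) = w := by
        rw [Matrix.mulVec_mulVec, ← map_mul, hA, map_one, Matrix.one_mulVec]
      rw [hw1, Matrix.mulVec_smul] at this
      rw [← this, smul_smul, inv_mul_cancel₀ hz0, one_smul, this]
    -- On an eigenvector with eigenvalue of modulus 1, `Mⁿ Q w = mⁿ Q w` has constant norm, whereas
    -- `Mⁿ Q` tends to 0. So both projections kill `w`, which contradicts `P + P' = 1`.
    have key (M Q : Matrix (Fin d) (Fin d) ℝ) (m : ℂ) (hm : ‖m‖ = 1) (hMQ : Q * M = M * Q)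
        (hMw : (complexify M).mulVec w = m • w)
        (hd : ∃ K ρ : ℝ, 0 < ρ ∧ ρ < 1 ∧ ∀ n : ℕ, ‖M ^ n * Q‖ ≤ K * ρ ^ n) :
        (complexify Q).mulVec w = 0 := by
      obtain ⟨K, ρ, h0, h1, hK⟩ := hd
      refine eq_zero_of_forall_norm_le_mul_pow (K := K * ‖w‖) h0.le h1 fun n => ?_
      have hpow : ∀ n : ℕ, (complexify M ^ n).mulVec w = m ^ n • w := by
        intro n
        induction n with
        | zero => simp
        | succ n ih => rw [pow_succ', ← Matrix.mulVec_mulVec, ih, Matrix.mulVec_smul, hMw,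
            smul_smul, pow_succ]
      have h2 : (complexify (M ^ n * Q)).mulVec w = m ^ n • (complexify Q).mulVec w := by
        have : M ^ n * Q = Q * M ^ n := (Commute.pow_left (show Commute M Q from hMQ.symm) n).eq
        rw [this, map_mul, map_pow, ← Matrix.mulVec_mulVec, hpow, Matrix.mulVec_smul]
      calc ‖(complexify Q).mulVec w‖ = ‖m ^ n • (complexify Q).mulVec w‖ := by
            rw [norm_smul, norm_pow, hm, one_pow, one_mul]
        _ ≤ ‖complexify (M ^ n * Q)‖ * ‖w‖ := by rw [← h2]; exact Matrix.linfty_opNorm_mulVec _ _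
        _ ≤ K * ρ ^ n * ‖w‖ := by rw [norm_complexify]; gcongr; exact hK n
        _ = _ := by ring
    have e1 := key A' P z⁻¹ (by rw [norm_inv, hz1, inv_one]) (hu.comm _ hcomm) hw2 hu.expand
    have e2 := key A P' z hz1 (hs.comm _ hcomm.symm) hw1 hs.expand
    have h1 : (1 : Matrix (Fin d) (Fin d) ℝ) = P + P' := by
      rw [sub_sub, sub_eq_zero] at h0; exact h0
    have : w = 0 := by
      rw [← Matrix.one_mulVec w, ← map_one complexify, h1, map_add, Matrix.add_mulVec, e1, e2,
        add_zero]
    exact hw.2 this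
  · intro hroots
    have hd1 := exists_decay_of_roots (A := A) (N := 1 - P)
      (fun z hz => lt_of_le_of_ne (not_lt.1 (Multiset.mem_filter.1 hz).2)
        (hroots z (Multiset.mem_filter.1 hz).1)) hP1
    have hd2 := exists_inv_decay_of_roots (N := 1 - P') hA
      (fun z hz => lt_of_le_of_ne (not_lt.1 (Multiset.mem_filter.1 hz).2)
        (hroots z (Multiset.mem_filter.1 hz).1).symm) hP1'
    -- Without roots of modulus 1 the bounds on the complements become exponential decay, so `1 - P`
    -- and `1 - P'` exchange roles with `P'` and `P`. Then `(1 - P') (1 - P) = 0` and `P' P = 0`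
    -- together give `1 - P - P' = 0`.
    have h1 : UnstableSplitting A' A (1 - P) :=
      { inv_mul := hA'
        idem := by rw [mul_sub, sub_mul, sub_mul, hPi]; simp
        comm := fun X hX => by
          rw [sub_mul, mul_sub, one_mul, mul_one, hu.comm X (hswap X hX)]
        expand := hd1
        slow := fun θ hθ => by
          obtain ⟨K, ρ, h0, h1, hK⟩ := hu.expand
          refine ⟨K, fun n => ?_⟩
          rw [sub_sub_cancel]
          refine (hK n).trans ?_
          have : 0 ≤ K := by simpa using (norm_nonneg _).trans (hK 0)
          gcongr
          exact (h1.trans hθ).le }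
    have h2 : UnstableSplitting A A' (1 - P') :=
      { inv_mul := hA
        idem := by rw [mul_sub, sub_mul, sub_mul, hPi']; simp
        comm := fun X hX => by
          have : A' * X = X * A' := by
            calc A' * X = A' * (X * A) * A' := by rw [mul_assoc, mul_assoc X, hA', mul_one]
              _ = X * A' := by rw [← hX, ← mul_assoc A', hA, one_mul]
          rw [sub_mul, mul_sub, one_mul, mul_one, hs.comm X this]
        expand := hd2
        slow := fun θ hθ => by
          obtain ⟨K, ρ, h0, h1, hK⟩ := hs.expand
          refine ⟨K, fun n => ?_⟩
          rw [sub_sub_cancel]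
          refine (hK n).trans ?_
          have : 0 ≤ K := by simpa using (norm_nonneg _).trans (hK 0)
          gcongr
          exact (h1.trans hθ).le }
    have := h2.mul_eq_zero h1
    have hPP := hs.mul_eq_zero hu
    rw [mul_sub, sub_mul, sub_mul, hPP] at this
    simp only [mul_one, one_mul, sub_zero] at this
    rw [sub_right_comm]
    exact this

end

/-! ### Rank factorization of projections -/

/-- `B` includes the range of `P` through a basis and `C` gives the coordinates of the projected
vector; `C * B = 1` because `P` fixes its range. The factorization turns the rank into a matrix
size, readable from determinants and traces. -/
theorem exists_rank_factorization {P : Matrix (Fin d) (Fin d) ℝ} (hP : P * P = P) :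
    ∃ (u : ℕ) (B : Matrix (Fin d) (Fin u) ℝ) (C : Matrix (Fin u) (Fin d) ℝ),
      P = B * C ∧ C * B = 1 := by
  set p := Matrix.toLin' P
  have hpp : ∀ x, p (p x) = p x := fun x => by
    simp only [p, Matrix.toLin'_apply, Matrix.mulVec_mulVec, hP]
  let e := (Module.finBasis ℝ (LinearMap.range p)).equivFun
  refine ⟨_, LinearMap.toMatrix' ((LinearMap.range p).subtype ∘ₗ e.symm.toLinearMap),
    LinearMap.toMatrix' (e.toLinearMap ∘ₗ p.rangeRestrict), ?_, ?_⟩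
  · rw [← LinearMap.toMatrix'_comp, ← LinearMap.toMatrix'_toLin' P]
    congr 1
    refine LinearMap.ext fun x => ?_
    simp [p]
  · rw [← LinearMap.toMatrix'_comp, ← LinearMap.toMatrix'_id]
    congr 1
    refine LinearMap.ext fun x => ?_
    have h : p.rangeRestrict (e.symm x) = e.symm x := by
      obtain ⟨y, hy⟩ := (e.symm x).2
      apply Subtype.ext
      rw [← hy]
      exact hpp _
    simp [h]

theorem det_smul_add_one_sub {u : ℕ} {B : Matrix (Fin d) (Fin u) ℝ} {C : Matrix (Fin u) (Fin d) ℝ}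
    (hCB : C * B = 1) (t : ℝ) : (t • (B * C) + (1 - B * C)).det = t ^ u := by
  have : t • (B * C) + (1 - B * C) = 1 + B * ((t - 1) • C) := by
    rw [Matrix.mul_smul, sub_smul, one_smul]; abel
  rw [this, Matrix.det_one_add_mul_comm, Matrix.smul_mul, hCB]
  have : (1 : Matrix (Fin u) (Fin u) ℝ) + (t - 1) • 1 = t • 1 := by
    rw [sub_smul, one_smul]; abel
  rw [this, Matrix.det_smul]
  simp

theorem trace_mul_of_mul_eq_one {u : ℕ} {B : Matrix (Fin d) (Fin u) ℝ}
    {C : Matrix (Fin u) (Fin d) ℝ} (hCB : C * B = 1) : (B * C).trace = u := by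
  rw [Matrix.trace_mul_comm, hCB]; simp

open MeasureTheory Set
open scoped Pointwise

/-! ### The projection `ℝ^d → 𝕋^d` -/

theorem toTorus_add (x y : Fin d → ℝ) : toTorus (x + y) = toTorus x + toTorus y := by
  funext i; simp [toTorus]

theorem toTorus_sub (x y : Fin d → ℝ) : toTorus (x - y) = toTorus x - toTorus y := by
  funext i; simp [toTorus]

theorem norm_toTorus_le (x : Fin d → ℝ) : ‖toTorus x‖ ≤ ‖x‖ := by
  refine (pi_norm_le_iff_of_nonneg (norm_nonneg _)).2 fun i => le_trans ?_ (norm_le_pi_norm x i)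
  have := round_le (x i) 0
  simpa [toTorus, UnitAddCircle.norm_eq] using this

theorem norm_toTorus_eq {x : Fin d → ℝ} (hx : ‖x‖ ≤ 1 / 2) : ‖toTorus x‖ = ‖x‖ := by
  have h (i : Fin d) : ‖toTorus x i‖ = ‖x i‖ := by
    have : |x i| ≤ 1 / 2 := (norm_le_pi_norm x i).trans hx
    rw [toTorus, Real.norm_eq_abs]
    exact (AddCircle.norm_coe_eq_abs_iff 1 one_ne_zero).2 (by simpa using this)
  simp_rw [Pi.norm_def, show ∀ i, ‖toTorus x i‖₊ = ‖x i‖₊ from fun i => NNReal.eq (h i)]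

theorem exists_toTorus_eq (y : Torus d) : ∃ x, toTorus x = y ∧ ‖x‖ = ‖y‖ := by
  have h (i : Fin d) : ∃ r : ℝ, (r : UnitAddCircle) = y i ∧ |r| ≤ 1 / 2 := by
    obtain ⟨r, hr⟩ := QuotientAddGroup.mk_surjective (y i)
    refine ⟨r - round r, ?_, abs_sub_round r⟩
    rw [← hr, AddCircle.coe_sub, sub_eq_self, AddCircle.coe_eq_zero_iff]
    exact ⟨round r, by simp⟩
  choose x hx hx2 using h
  have hy : toTorus x = y := funext hx
  refine ⟨x, hy, ?_⟩
  rw [← hy, norm_toTorus_eq]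
  exact (pi_norm_le_iff_of_nonneg (by norm_num)).2 hx2

theorem isOpenMap_toTorus : IsOpenMap (toTorus (d := d)) :=
  IsOpenMap.piMap (f := fun (_ : Fin d) (r : ℝ) => (r : UnitAddCircle))
    (fun _ => QuotientAddGroup.isOpenMap_coe)
    (by simp)

theorem measurePreserving_toTorus :
    MeasurePreserving (toTorus (d := d))
      (volume.restrict (univ.pi fun _ => Ioc (-1 / 2 : ℝ) (-1 / 2 + 1))) volume := by
  have := measurePreserving_pi (fun _ : Fin d => volume.restrict (Ioc (-1 / 2 : ℝ) (-1 / 2 + 1)))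
    (fun _ => (volume : Measure UnitAddCircle)) (fun _ => UnitAddCircle.measurePreserving_mk (-1 / 2))
  rw [← Measure.restrict_pi_pi] at this
  exact this

/-- The projection preserves the volume of open sets contained in the ball of radius `1/2`. -/
theorem volume_toTorus_image {E : Set (Fin d → ℝ)} (hE : IsOpen E) (hE2 : ∀ x ∈ E, ‖x‖ < 1 / 2) :
    volume (toTorus '' E) = volume E := by
  have hmeas := (isOpenMap_toTorus E hE).measurableSet
  rw [← measurePreserving_toTorus.measure_preimage hmeas.nullMeasurableSet,
    Measure.restrict_apply (measurePreserving_toTorus.measurable hmeas)]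
  congr 1
  ext x
  constructor
  · rintro ⟨⟨y, hy, hyx⟩, hx⟩
    suffices h : y = x from h ▸ hy
    funext i
    have h1 := congrFun hyx i
    simp only [toTorus] at h1
    obtain ⟨n, hn⟩ := (AddCircle.coe_eq_zero_iff (1 : ℝ) (x := y i - x i)).1
      (by rw [AddCircle.coe_sub, h1, sub_self])
    -- Two representatives, one in `(-1/2, 1/2)` and one in `(-1/2, 1/2]`, differ by an integer of
    -- absolute value less than 1.
    have h2 := (norm_le_pi_norm y i).trans_lt (hE2 y hy)
    rw [Real.norm_eq_abs, abs_lt] at h2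
    have h3 := hx i (mem_univ i)
    rw [zsmul_one] at hn
    have h4 : n = 0 := by
      have h5 : (-1 : ℝ) < n := by linarith [h2.1, h3.2]
      have h6 : (n : ℝ) < 1 := by linarith [h2.2, h3.1]
      have h7 : -1 < n := by exact_mod_cast h5
      have h8 : n < 1 := by exact_mod_cast h6
      omega
    rw [h4, Int.cast_zero] at hn
    linarith
  · intro hx
    refine ⟨⟨x, hx, rfl⟩, fun i _ => ?_⟩
    have := (norm_le_pi_norm x i).trans_lt (hE2 x hx)
    rw [Real.norm_eq_abs, abs_lt] at this
    constructor <;> linarith [this.1, this.2]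

theorem volume_add_toTorus_image (x : Torus d) {E : Set (Fin d → ℝ)} (hE : IsOpen E)
    (hE2 : ∀ x ∈ E, ‖x‖ < 1 / 2) :
    volume ((fun v => x + toTorus v) '' E) = volume E := by
  rw [← volume_toTorus_image hE hE2, ← measure_preimage_add volume (-x) (toTorus '' E)]
  congr 1
  ext y
  simp only [mem_image, mem_preimage]
  exact exists_congr fun v => and_congr_right fun _ => by rw [eq_neg_add_iff_add_eq]

/-! ### Linear maps of the torus -/

/-- An integer matrix seen as a real matrix. -/
abbrev realMatrix : Matrix (Fin d) (Fin d) ℤ →+* Matrix (Fin d) (Fin d) ℝ :=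
  (Int.castRingHom ℝ).mapMatrix

theorem matrixMap_sub (A : Matrix (Fin d) (Fin d) ℤ) (x y : Torus d) :
    matrixMap A (x - y) = matrixMap A x - matrixMap A y := by
  funext i
  simp [matrixMap, smul_sub, Finset.sum_sub_distrib]

theorem matrixMap_toTorus (A : Matrix (Fin d) (Fin d) ℤ) (x : Fin d → ℝ) :
    matrixMap A (toTorus x) = toTorus ((realMatrix A).mulVec x) := by
  funext i
  simp only [matrixMap, toTorus, Matrix.mulVec, dotProduct]
  refine Eq.trans (Finset.sum_congr rfl fun j _ => ?_)
    (map_sum (QuotientAddGroup.mk' (AddSubgroup.zmultiples (1 : ℝ))) _ _).symm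
  rw [← AddCircle.coe_zsmul, zsmul_eq_mul]
  rfl

theorem matrixMap_iterate (A : Matrix (Fin d) (Fin d) ℤ) (n : ℕ) :
    (matrixMap A)^[n] = matrixMap (A ^ n) := by
  induction n with
  | zero => funext x; simp [matrixMap_one]
  | succ n ih => funext x; rw [Function.iterate_succ_apply', ih, pow_succ', matrixMap_mul]

/-! ### Boxes adapted to a splitting -/

/-- The product of the ball of radius `a` in the range of `P` and of the ball of radius `b` in its
kernel. -/
def box (P : Matrix (Fin d) (Fin d) ℝ) (a b : ℝ) : Set (Fin d → ℝ) :=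
  {v | ‖P.mulVec v‖ < a ∧ ‖(1 - P).mulVec v‖ < b}

section Box

variable {P : Matrix (Fin d) (Fin d) ℝ} {a b : ℝ}

theorem isOpen_box : IsOpen (box P a b) :=
  (isOpen_lt (f := fun v => ‖P.mulVec v‖) (by fun_prop) continuous_const).inter
    (isOpen_lt (f := fun v => ‖(1 - P).mulVec v‖) (by fun_prop) continuous_const)

theorem norm_lt_of_mem_box {v : Fin d → ℝ} (hv : v ∈ box P a b) : ‖v‖ < a + b := by
  have : v = P.mulVec v + (1 - P).mulVec v := by rw [← Matrix.add_mulVec]; simp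
  calc ‖v‖ = ‖P.mulVec v + (1 - P).mulVec v‖ := by rw [← this]
    _ ≤ _ := norm_add_le _ _
    _ < a + b := add_lt_add hv.1 hv.2

theorem volume_box_lt_top : volume (box P a b) < ⊤ := by
  refine (Bornology.IsBounded.subset (Metric.isBounded_ball (x := 0) (r := a + b))
    fun v hv => ?_).measure_lt_top
  simpa using norm_lt_of_mem_box hv

theorem volume_box_pos (ha : 0 < a) (hb : 0 < b) : 0 < volume (box P a b) :=
  isOpen_box.measure_pos _ ⟨0, by simp [box, ha, hb]⟩

theorem volume_box_smul {c : ℝ} (hc : 0 < c) :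
    volume (box P (c * a) (c * b)) = ENNReal.ofReal (c ^ d) * volume (box P a b) := by
  have : box P (c * a) (c * b) = (fun x => c⁻¹ • x) ⁻¹' box P a b := by
    ext v
    simp only [box, mem_ofPred_eq, mem_preimage, Matrix.mulVec_smul, norm_smul, norm_inv,
      Real.norm_of_nonneg hc.le, inv_mul_lt_iff₀ hc]
  rw [this, Measure.addHaar_preimage_smul _ (inv_ne_zero hc.ne')]
  simp [abs_of_pos hc]

theorem volume_preimage_mulVec {F : Matrix (Fin d) (Fin d) ℝ} (hF : F.det ≠ 0)
    (s : Set (Fin d → ℝ)) :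
    volume (F.mulVec ⁻¹' s) = ENNReal.ofReal |F.det|⁻¹ * volume s := by
  have := Measure.addHaar_preimage_linearMap volume (f := Matrix.toLin' F)
    (by rwa [LinearMap.det_toLin']) s
  rw [LinearMap.det_toLin', abs_inv] at this
  exact this

/-- Contracting the range of a rank `u` projection by `c` multiplies the volume by `c ^ u`. -/
theorem volume_box_mul_left (hP : P * P = P) {u : ℕ} {B : Matrix (Fin d) (Fin u) ℝ}
    {C : Matrix (Fin u) (Fin d) ℝ} (hBC : P = B * C) (hCB : C * B = 1) {c : ℝ} (hc : 0 < c) :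
    volume (box P (c * a) b) = ENNReal.ofReal (c ^ u) * volume (box P a b) := by
  have hdet : (c⁻¹ • P + (1 - P)).det = c⁻¹ ^ u := by rw [hBC]; exact det_smul_add_one_sub hCB _
  have : box P (c * a) b = (c⁻¹ • P + (1 - P)).mulVec ⁻¹' box P a b := by
    ext v
    have h1 : P * (c⁻¹ • P + (1 - P)) = c⁻¹ • P := by
      rw [mul_add, mul_sub, Matrix.mul_smul, hP]; simp
    have h2 : (1 - P) * (c⁻¹ • P + (1 - P)) = 1 - P := by
      rw [mul_add, mul_sub, Matrix.mul_smul, sub_mul, sub_mul, hP]; simp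
    simp only [box, mem_ofPred_eq, mem_preimage, Matrix.mulVec_mulVec, h1, h2, Matrix.smul_mulVec,
      norm_smul, norm_inv, Real.norm_of_nonneg hc.le, inv_mul_lt_iff₀ hc]
  rw [this, volume_preimage_mulVec (by rw [hdet]; positivity), hdet]
  congr 2
  rw [abs_of_pos (by positivity), inv_pow, inv_inv]

end Box

/-! ### Linear dynamics of an unstable splitting -/

section Linear

variable {R R' P : Matrix (Fin d) (Fin d) ℝ}

/-- The map that agrees with `R` on the range of `P` and with the identity on its kernel. -/
def unstablePart (R P : Matrix (Fin d) (Fin d) ℝ) : Matrix (Fin d) (Fin d) ℝ := R * P + (1 - P)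

/-- The expansion factor of the volume in the unstable directions. -/
def unstableVolume (R P : Matrix (Fin d) (Fin d) ℝ) : ℝ := |(unstablePart R P).det|

namespace UnstableSplitting

variable (h : UnstableSplitting R R' P)
include h

theorem mul_comm_pow (n : ℕ) : P * R ^ n = R ^ n * P := h.comm _ (Commute.self_pow R n)

theorem compl_mul_self : (1 - P) * P = 0 := by rw [sub_mul, h.idem, one_mul, sub_self]

theorem self_mul_compl : P * (1 - P) = 0 := by rw [mul_sub, h.idem, mul_one, sub_self]

theorem compl_idem : (1 - P) * (1 - P) = 1 - P := by
  rw [mul_sub, h.compl_mul_self, mul_one, sub_zero]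

/-- The matrix `R' P + (1 - P)` is an explicit left inverse of `unstablePart R P`. -/
theorem unstableVolume_pos : 0 < unstableVolume R P := by
  have hPR : P * R = R * P := h.comm R rfl
  have : (R' * P + (1 - P)) * unstablePart R P = 1 := by
    have e1 : R' * P * (R * P) = P := by
      rw [mul_assoc, ← mul_assoc P, hPR, mul_assoc R, h.idem, ← mul_assoc, h.inv_mul, one_mul]
    have e2 : R' * P * (1 - P) = 0 := by rw [mul_assoc, h.self_mul_compl, mul_zero]
    have e3 : (1 - P) * (R * P) = 0 := by
      rw [← hPR, ← mul_assoc, h.compl_mul_self, zero_mul]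
    rw [unstablePart, mul_add, add_mul, add_mul, e1, e2, e3, h.compl_idem]
    abel
  have := congrArg Matrix.det this
  rw [Matrix.det_mul, Matrix.det_one] at this
  exact abs_pos.2 (right_ne_zero_of_mul (this.trans_ne one_ne_zero))

theorem mul_unstablePart_pow (n : ℕ) : P * unstablePart R P ^ n = R ^ n * P := by
  induction n with
  | zero => simp
  | succ n ih =>
    rw [pow_succ, ← mul_assoc, ih, unstablePart, mul_add, mul_assoc, ← mul_assoc P,
      h.comm R rfl, mul_assoc R, h.idem, mul_assoc, h.self_mul_compl, mul_zero, add_zero,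
      pow_succ, mul_assoc]

theorem compl_mul_unstablePart_pow (n : ℕ) : (1 - P) * unstablePart R P ^ n = 1 - P := by
  induction n with
  | zero => simp
  | succ n ih =>
    rw [pow_succ, ← mul_assoc, ih, unstablePart, mul_add, ← h.comm R rfl, ← mul_assoc,
      h.compl_mul_self, zero_mul, zero_add, h.compl_idem]

/-- These preimages are the models of dynamical balls: the unstable condition is imposed at time
`n`, the other at time 0, and `volume_preimage_box` gives their exact volume. -/
theorem mem_preimage_box {n : ℕ} {a b : ℝ} {v : Fin d → ℝ} :
    v ∈ (unstablePart R P ^ n).mulVec ⁻¹' box P a b ↔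
      ‖(R ^ n * P).mulVec v‖ < a ∧ ‖(1 - P).mulVec v‖ < b := by
  simp only [box, mem_preimage, mem_ofPred_eq, Matrix.mulVec_mulVec, h.mul_unstablePart_pow,
    h.compl_mul_unstablePart_pow]

theorem volume_preimage_box (n : ℕ) (s : Set (Fin d → ℝ)) :
    volume ((unstablePart R P ^ n).mulVec ⁻¹' s) =
      ENNReal.ofReal (unstableVolume R P)⁻¹ ^ n * volume s := by
  have h0 := h.unstableVolume_pos
  rw [volume_preimage_mulVec, Matrix.det_pow, abs_pow, ← inv_pow, ENNReal.ofReal_pow]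
  · rfl
  · exact inv_nonneg.2 h0.le
  · rw [Matrix.det_pow]
    exact pow_ne_zero _ (abs_pos.1 h0)

omit h in
theorem isOpen_preimage_box {n : ℕ} {a b : ℝ} :
    IsOpen ((unstablePart R P ^ n).mulVec ⁻¹' box P a b) :=
  isOpen_box.preimage (by fun_prop)

theorem inv_pow_mul_pow (n : ℕ) : R' ^ n * R ^ n = 1 := by
  have hcomm : Commute R' R := h.inv_mul.trans (mul_eq_one_comm.1 h.inv_mul).symm
  rw [← hcomm.mul_pow, h.inv_mul, one_pow]

/-- Unstable vectors are small when their forward images are bounded. -/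
theorem norm_mulVec_le {K ρ : ℝ} (hK : ∀ n : ℕ, ‖R' ^ n * P‖ ≤ K * ρ ^ n) (j m : ℕ)
    (v : Fin d → ℝ) :
    ‖(R ^ j * P).mulVec v‖ ≤ K * ρ ^ m * ‖(R ^ (j + m) * P).mulVec v‖ := by
  have e : R ^ j * P = R' ^ m * P * (R ^ (j + m) * P) := by
    rw [mul_assoc, ← mul_assoc P, h.mul_comm_pow, mul_assoc (R ^ (j + m)), h.idem, add_comm j m,
      pow_add, mul_assoc, ← mul_assoc (R' ^ m), h.inv_pow_mul_pow, one_mul]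
  calc _ ≤ ‖R' ^ m * P‖ * ‖(R ^ (j + m) * P).mulVec v‖ := by
        rw [e, ← Matrix.mulVec_mulVec]
        exact Matrix.linfty_opNorm_mulVec _ _
    _ ≤ _ := by gcongr; exact hK m

/-- Vectors whose orbit stays small up to time `n`. -/
theorem exists_forall_norm_pow_mulVec_lt {θ ε : ℝ} (hθ0 : 0 < θ) (hθ1 : θ < 1) (hε : 0 < ε) :
    ∃ r, 0 < r ∧ ∀ n : ℕ, ∀ v, ‖(R ^ n * P).mulVec v‖ < r → ‖(1 - P).mulVec v‖ < r * θ ^ n →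
      ∀ j ≤ n, ‖(R ^ j).mulVec v‖ < ε := by
  obtain ⟨K, ρ, h0, h1, hK⟩ := h.expand
  -- The growth `θ⁻ʲ` allowed on the kernel is compensated by the initial size `r θⁿ`, as `j ≤ n`.
  obtain ⟨K', hK'⟩ := h.slow θ⁻¹ ((one_lt_inv₀ hθ0).2 hθ1)
  have hK0 : 0 ≤ K := by simpa using (norm_nonneg _).trans (hK 0)
  have hK0' : 0 ≤ K' := by simpa using (norm_nonneg _).trans (hK' 0)
  refine ⟨ε / (K + K' + 1), by positivity, fun n v hv1 hv2 j hj => ?_⟩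
  set r := ε / (K + K' + 1) with hr
  have hr0 : 0 < r := by positivity
  have e : (R ^ j).mulVec v = (R ^ j * P).mulVec v +
      (R ^ j * (1 - P)).mulVec ((1 - P).mulVec v) := by
    rw [Matrix.mulVec_mulVec, mul_assoc, h.compl_idem, ← Matrix.add_mulVec, ← mul_add]
    simp
  have b1 : ‖(R ^ j * P).mulVec v‖ ≤ K * r := by
    have := h.norm_mulVec_le hK j (n - j) v
    rw [Nat.add_sub_cancel' hj] at this
    refine this.trans ?_
    have : ρ ^ (n - j) ≤ 1 := pow_le_one₀ h0.le h1.le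
    calc K * ρ ^ (n - j) * ‖(R ^ n * P).mulVec v‖ ≤ K * 1 * r := by gcongr
      _ = K * r := by ring
  have b2 : ‖(R ^ j * (1 - P)).mulVec ((1 - P).mulVec v)‖ ≤ K' * r := by
    refine (Matrix.linfty_opNorm_mulVec _ _).trans ?_
    calc _ ≤ (K' * θ⁻¹ ^ j) * (r * θ ^ n) := by gcongr; exact hK' j
      _ ≤ (K' * θ⁻¹ ^ j) * (r * θ ^ j) := by
        exact mul_le_mul_of_nonneg_left (mul_le_mul_of_nonneg_left
          (pow_le_pow_of_le_one hθ0.le hθ1.le hj) hr0.le) (by positivity)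
      _ = K' * r := by
        rw [inv_pow]
        field_simp
  rw [e]
  calc _ ≤ _ := norm_add_le _ _
    _ ≤ K * r + K' * r := add_le_add b1 b2
    _ < (K + K' + 1) * r := by linarith
    _ = ε := by rw [hr]; field_simp

end UnstableSplitting

end Linear

/-! ### Dynamical balls of torus automorphisms -/

/-- The entourage `{(x, y) | dist x y < ε}`. -/
def distEntourage (X : Type*) [PseudoMetricSpace X] (ε : ℝ) : SetRel X X :=
  {p | dist p.1 p.2 < ε}

instance {X : Type*} [PseudoMetricSpace X] {ε : ℝ} : (distEntourage X ε).IsSymm :=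
  ⟨fun x y (h : dist x y < ε) => show dist y x < ε by rwa [dist_comm]⟩

theorem mem_dynEntourage_matrixMap {A : Matrix (Fin d) (Fin d) ℤ} {ε : ℝ} {n : ℕ} {x y : Torus d} :
    (x, y) ∈ dynEntourage (matrixMap A) (distEntourage _ ε) n ↔
      ∀ j < n, ‖matrixMap (A ^ j) (y - x)‖ < ε := by
  rw [mem_dynEntourage]
  refine forall₂_congr fun j _ => ?_
  rw [matrixMap_iterate, matrixMap_sub, ← dist_eq_norm, dist_comm]
  rfl

theorem norm_matrixMap_pow_toTorus_le (A : Matrix (Fin d) (Fin d) ℤ) (n : ℕ) (v : Fin d → ℝ) :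
    ‖matrixMap (A ^ n) (toTorus v)‖ ≤ ‖(realMatrix A ^ n).mulVec v‖ := by
  rw [matrixMap_toTorus, map_pow]
  exact norm_toTorus_le _

/-- Points of a small dynamical ball of the torus lift to the dynamical ball of `ℝ^d`. -/
theorem exists_lift_of_forall_norm_lt {A : Matrix (Fin d) (Fin d) ℤ} {ε : ℝ}
    (hε2 : ‖realMatrix A‖ * ε ≤ 1 / 2) {n : ℕ} {y : Torus d}
    (hy : ∀ j < n + 1, ‖matrixMap (A ^ j) y‖ < ε) :
    ∃ v, toTorus v = y ∧ ∀ j < n + 1, ‖(realMatrix A ^ j).mulVec v‖ < ε := by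
  obtain ⟨v, hv, hvn⟩ := exists_toTorus_eq y
  refine ⟨v, hv, fun j hj => ?_⟩
  induction j with
  | zero =>
    have := hy 0 hj
    rw [pow_zero, matrixMap_one] at this
    simpa [hvn] using this
  | succ j ih =>
    -- A single step multiplies norms by at most `‖realMatrix A‖`, so the next iterate stays in the
    -- ball of radius `1/2`, where the projection preserves norms and the hypothesis on the torus
    -- applies to the lift.
    have h1 := ih (by omega)
    have h2 : ‖(realMatrix A ^ (j + 1)).mulVec v‖ ≤ 1 / 2 := by
      rw [pow_succ', ← Matrix.mulVec_mulVec]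
      refine (Matrix.linfty_opNorm_mulVec _ _).trans (le_trans ?_ hε2)
      gcongr
    rw [← norm_toTorus_eq h2, ← map_pow, ← matrixMap_toTorus, hv]
    exact hy _ hj

/-- A maximal net of scale `ε / 2` yields a cover of scale `ε`, so it suffices to count disjoint
dynamical balls, which volumes can do. `C` may depend on the scale; only the rate `b` matters. -/
theorem uniformFamilyEntropy_le {X : Type*} [PseudoMetricSpace X] {f : X → X} {𝒟 : Set (Set X)}
    {b : ENNReal} (h : ∀ ε > 0, ∃ C : ENNReal, C ≠ ⊤ ∧ ∀ᶠ n : ℕ in atTop, ∀ S ∈ 𝒟, ∀ s : Finset X,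
      IsDynNetIn f S (distEntourage X ε) n s → (s.card : ENNReal) ≤ C * b ^ n) :
    uniformFamilyEntropy f 𝒟 ≤ ENNReal.log b := by
  refine iSup₂_le fun V hV => ?_
  obtain ⟨ε, hε, hεV⟩ := Metric.mem_uniformity_dist.1 hV
  obtain ⟨C, hC, hn⟩ := h (ε / 2) (by positivity)
  rw [← ExpGrowth.expGrowthSup_pow]
  refine ExpGrowth.expGrowthSup_le_of_eventually_le hC ?_
  filter_upwards [hn] with n hn
  refine iSup₂_le fun S hS => ?_
  have hrefl : (distEntourage X (ε / 2)).IsRefl := ⟨fun x => by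
    change dist x x < ε / 2
    rw [dist_self]; positivity⟩
  have h1 : coverMincard f S V n ≤ netMaxcard f S (distEntourage X (ε / 2)) n := by
    refine le_trans (coverMincard_antitone f S n ?_) (coverMincard_le_netMaxcard f S n)
    rintro ⟨x, y⟩ ⟨z, hxz, hzy⟩
    apply hεV
    have e1 : dist x z < ε / 2 := hxz
    have e2 : dist z y < ε / 2 := hzy
    linarith [dist_triangle x z y]
  refine (ENat.toENNReal_le.2 h1).trans ?_
  rw [netMaxcard, ENat.toENNReal_iSup]
  refine iSup_le fun s => ?_
  rw [ENat.toENNReal_iSup]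
  refine iSup_le fun hs => ?_
  simpa using hn S hS s hs

/-- Lets one uniform bound serve for both kinds of dimensional entropy. -/
theorem coverEntropy_eq_uniformFamilyEntropy {X : Type*} [UniformSpace X] (f : X → X) (S : Set X) :
    coverEntropy f S = uniformFamilyEntropy f {S} := by
  simp [coverEntropy, uniformFamilyEntropy, coverEntropyEntourage]

/-! ### Upper bounds for the entropy -/

/-- `S` is covered by `K δ⁻ᵏ` balls of radius `K δ` for each `0 < δ ≤ 1`. -/
def HasCoverDim {X : Type*} [PseudoMetricSpace X] (S : Set X) (k : ℕ) (K : ℝ) : Prop :=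
  ∀ δ : ℝ, 0 < δ → δ ≤ 1 → ∃ t : Finset X, (t.card : ℝ) * δ ^ k ≤ K ∧
    ∀ x ∈ S, ∃ y ∈ t, dist x y ≤ K * δ

theorem div_mul_ofReal_div_pow {c X : ENNReal} {p q : ℝ} (hq : 0 < q) (hc : c ≠ 0) (hc' : c ≠ ⊤)
    (n : ℕ) : X / c * ENNReal.ofReal (p / q) ^ n =
      X * ENNReal.ofReal p ^ n / (c * ENNReal.ofReal q ^ n) := by
  rw [ENNReal.ofReal_div_of_pos hq, ENNReal.div_eq_inv_mul, ENNReal.div_eq_inv_mul,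
    ENNReal.div_eq_inv_mul, mul_pow, ENNReal.mul_inv (Or.inl hc) (Or.inl hc'), ENNReal.inv_pow]
  ring

theorem le_mul_ofReal_div_pow {N c X : ENNReal} {p q : ℝ} (hq : 0 < q) (hc : c ≠ 0)
    (hc' : c ≠ ⊤) {n : ℕ} (h : N * (c * ENNReal.ofReal q ^ n) ≤ X * ENNReal.ofReal p ^ n) :
    N ≤ X / c * ENNReal.ofReal (p / q) ^ n := by
  have hq0 : ENNReal.ofReal q ^ n ≠ 0 := pow_ne_zero _ (by simpa using hq)
  have hq1 : ENNReal.ofReal q ^ n ≠ ⊤ := ENNReal.pow_ne_top ENNReal.ofReal_ne_top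
  rwa [div_mul_ofReal_div_pow hq hc hc', ENNReal.le_div_iff_mul_le
    (Or.inl (mul_ne_zero hc hq0)) (Or.inl (ENNReal.mul_ne_top hc' hq1))]

/-! ### Counting dynamical balls by volume. -/

namespace UnstableSplitting

variable {A : Matrix (Fin d) (Fin d) ℤ} {R' P : Matrix (Fin d) (Fin d) ℝ}
  (h : UnstableSplitting (realMatrix A) R' P)
include h

/-- A dynamical net is bounded by the ratio of volumes. -/
theorem exists_net_card_mul_le {θ ε : ℝ} (hθ0 : 0 < θ) (hθ1 : θ < 1) (hε : 0 < ε) :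
    ∃ r : ℝ, 0 < r ∧ r ≤ 1 / 8 ∧ ∃ c : ENNReal, c ≠ 0 ∧ c ≠ ⊤ ∧ ∀ (n : ℕ) (S W : Set (Torus d))
      (s : Finset (Torus d)), IsDynNetIn (matrixMap A) S (distEntourage _ ε) n s →
      (∀ x ∈ S, ∀ v, ‖(realMatrix A ^ n * P).mulVec v‖ < r → ‖(1 - P).mulVec v‖ < r →
        x + toTorus v ∈ W) →
      (s.card : ENNReal) *
        (c * ENNReal.ofReal (θ ^ d * (unstableVolume (realMatrix A) P)⁻¹) ^ n) ≤ volume W := by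
  obtain ⟨r₀, hr₀, hsh⟩ := h.exists_forall_norm_pow_mulVec_lt hθ0 hθ1
    (show 0 < min ε (1 / 2) by positivity)
  -- The bound `1 / 8` keeps the boxes of `uniformFamilyEntropy_lt` inside the ball of radius `1 /
  -- 2`.
  set r := min r₀ (1 / 8) with hr
  have hr0 : 0 < r := by positivity
  refine ⟨r, hr0, min_le_right _ _, volume (box P r r), (volume_box_pos hr0 hr0).ne',
    volume_box_lt_top.ne, fun n S W s hs hW => ?_⟩
  have hθn : 0 < θ ^ n := by positivity
  have hθd : 0 < θ ^ d := by positivity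
  have hθn1 : θ ^ n ≤ 1 := pow_le_one₀ hθ0.le hθ1.le
  -- Only the kernel side has to shrink by `θⁿ`; shrinking both makes the box a homothetic copy, of
  -- volume factor `θ^(n d)` whatever the rank of `P`.
  set N : Set (Fin d → ℝ) := (unstablePart (realMatrix A) P ^ n).mulVec ⁻¹' box P (θ ^ n * r) (θ ^ n * r)
    with hN
  have hNr {v} (hv : v ∈ N) : ‖(realMatrix A ^ n * P).mulVec v‖ < r ∧ ‖(1 - P).mulVec v‖ < r := by
    have := h.mem_preimage_box.1 hv
    have h3 : θ ^ n * r ≤ r := mul_le_of_le_one_left hr0.le hθn1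
    exact ⟨this.1.trans_le h3, this.2.trans_le h3⟩
  have hNsh {v} (hv : v ∈ N) : ∀ j ≤ n, ‖(realMatrix A ^ j).mulVec v‖ < min ε (1 / 2) := by
    refine hsh n v ((hNr hv).1.trans_le (min_le_left _ _))
      ((h.mem_preimage_box.1 hv).2.trans_le ?_)
    rw [mul_comm]
    gcongr
    exact min_le_left _ _
  have hNhalf : ∀ v ∈ N, ‖v‖ < 1 / 2 := fun v hv => by
    have := hNsh hv 0 n.zero_le
    rw [pow_zero, Matrix.one_mulVec] at this
    exact this.trans_le (min_le_right _ _)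
  have hNopen : IsOpen N := isOpen_preimage_box
  have hvol : volume N = volume (box P r r) *
      ENNReal.ofReal (θ ^ d * (unstableVolume (realMatrix A) P)⁻¹) ^ n := by
    rw [hN, h.volume_preimage_box, volume_box_smul hθn, ENNReal.ofReal_mul (by positivity), mul_pow,
      pow_right_comm θ n d, ENNReal.ofReal_pow hθd.le]
    ring
  have hopen (x : Torus d) : IsOpen ((fun v => x + toTorus v) '' N) := by
    rw [← image_image (fun y => x + y)]
    exact (isOpenMap_add_left x) _ (isOpenMap_toTorus N hNopen)
  calc (s.card : ENNReal) * (volume (box P r r) *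
        ENNReal.ofReal (θ ^ d * (unstableVolume (realMatrix A) P)⁻¹) ^ n)
      = ∑ x ∈ s, volume ((fun v => x + toTorus v) '' N) := by
        simp only [volume_add_toTorus_image _ hNopen hNhalf, hvol, Finset.sum_const, nsmul_eq_mul]
    -- The translates of `N` lie in the dynamical balls of the net points, which are disjoint by the
    -- definition of a net.
    _ = volume (⋃ x ∈ s, (fun v => x + toTorus v) '' N) := by
        rw [measure_biUnion_finset _ fun x _ => (hopen x).measurableSet]
        refine hs.2.mono fun x => ?_
        rintro _ ⟨v, hv, rfl⟩
        refine mem_dynEntourage_matrixMap.2 fun j hj => ?_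
        rw [add_sub_cancel_left]
        exact (norm_matrixMap_pow_toTorus_le _ _ _).trans_lt
          ((hNsh hv j hj.le).trans_le (min_le_left _ _))
    _ ≤ volume W := by
        refine measure_mono (iUnion₂_subset fun x hx => ?_)
        rintro _ ⟨v, hv, rfl⟩
        exact hW x (hs.1 hx) v (hNr hv).1 (hNr hv).2

omit h in
theorem log_ofReal_le_of_forall {D : ℝ} {e : EReal}
    (hD : ∀ θ : ℝ, 0 < θ → θ < 1 → e ≤ ENNReal.log (ENNReal.ofReal (D / θ ^ d))) :
    e ≤ ENNReal.log (ENNReal.ofReal D) := by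
  have hev : ∀ᶠ θ : ℝ in 𝓝[<] 1, e ≤ ENNReal.log (ENNReal.ofReal (D / θ ^ d)) := by
    filter_upwards [Ioo_mem_nhdsLT (zero_lt_one (α := ℝ))] with θ hθ using hD θ hθ.1 hθ.2
  refine ge_of_tendsto (Tendsto.mono_left ?_ nhdsWithin_le_nhds) hev
  have hc : ContinuousAt (fun θ : ℝ => ENNReal.log (ENNReal.ofReal (D / θ ^ d))) 1 := by
    have : ContinuousAt (fun θ : ℝ => D / θ ^ d) 1 :=
      continuousAt_const.div (by fun_prop) (by simp)
    exact ENNReal.continuous_log.continuousAt.comp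
      (ENNReal.continuous_ofReal.continuousAt.comp this)
  simpa [ContinuousAt] using hc

theorem topEntropy_le :
    topEntropy (matrixMap A) ≤ ENNReal.log (ENNReal.ofReal (unstableVolume (realMatrix A) P)) := by
  refine log_ofReal_le_of_forall (d := d) fun θ hθ0 hθ1 => ?_
  rw [topEntropy, coverEntropy_eq_uniformFamilyEntropy]
  refine uniformFamilyEntropy_le fun ε hε => ?_
  obtain ⟨r, -, -, c, hc0, hc1, hc⟩ := h.exists_net_card_mul_le hθ0 hθ1 hε
  have hD := h.unstableVolume_pos
  refine ⟨volume (univ : Set (Torus d)) / c, ENNReal.div_ne_top (measure_ne_top _ _) hc0,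
    Eventually.of_forall fun n S _ s hs => ?_⟩
  have := hc n S univ s hs (by simp)
  have e : unstableVolume (realMatrix A) P / θ ^ d =
      1 / (θ ^ d * (unstableVolume (realMatrix A) P)⁻¹) := by field_simp
  rw [e]
  exact le_mul_ofReal_div_pow (by positivity) hc0 hc1 (by simpa using this)

/-- Families of sets of dimension `k` smaller than the unstable dimension have smaller entropy. -/
theorem uniformFamilyEntropy_lt {u k : ℕ} {B : Matrix (Fin d) (Fin u) ℝ}
    {C : Matrix (Fin u) (Fin d) ℝ} (hBC : P = B * C) (hCB : C * B = 1) (hk : k < u) :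
    ∃ e < ENNReal.log (ENNReal.ofReal (unstableVolume (realMatrix A) P)), ∀ K : ℝ,
      ∀ 𝒟 : Set (Set (Torus d)), (∀ S ∈ 𝒟, HasCoverDim S k K) →
      uniformFamilyEntropy (matrixMap A) 𝒟 ≤ e := by
  obtain ⟨K', ρ, hρ0, hρ1, hK'⟩ := h.expand
  have hD := h.unstableVolume_pos
  set D := unstableVolume (realMatrix A) P with hDdef
  -- The loss `θ⁻ᵈ` must be smaller than the gain `ρ⁻¹` due to at least one missing dimension.
  -- Neither `K` nor `𝒟` enters this choice.
  obtain ⟨θ, hθ, hθ0, hθ1⟩ : ∃ θ : ℝ, ρ < θ ^ d ∧ 0 < θ ∧ θ < 1 := by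
    have hc : Tendsto (fun θ : ℝ => θ ^ d) (𝓝[<] 1) (𝓝 1) := by
      have : ContinuousAt (fun θ : ℝ => θ ^ d) 1 := by fun_prop
      simpa [ContinuousAt] using this.mono_left nhdsWithin_le_nhds
    obtain ⟨θ, h1, h2⟩ := ((hc.eventually (lt_mem_nhds hρ1)).and
      (Ioo_mem_nhdsLT (zero_lt_one (α := ℝ)))).exists
    exact ⟨θ, h1, h2.1, h2.2⟩
  have hθd : 0 < θ ^ d := by positivity
  have hlt : ρ ^ (u - k) / (θ ^ d * D⁻¹) < D := by
    have : ρ ^ (u - k) ≤ ρ := pow_le_of_le_one hρ0.le hρ1.le (by omega)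
    rw [div_lt_iff₀ (by positivity), mul_comm, mul_assoc, inv_mul_cancel₀ hD.ne', mul_one]
    exact this.trans_lt hθ
  refine ⟨_, ENNReal.log_strictMono ((ENNReal.ofReal_lt_ofReal_iff hD).2 hlt), fun K 𝒟 h𝒟 => ?_⟩
  refine uniformFamilyEntropy_le fun ε hε => ?_
  obtain ⟨r, hr0, hr1, c, hc0, hc1, hc⟩ := h.exists_net_card_mul_le hθ0 hθ1 hε
  have hK'0 : 0 ≤ K' := by simpa using (norm_nonneg _).trans (hK' 0)
  -- Unstable width in units of `ρⁿ`: the distance to the nearest centre contributes `‖P‖ * |K|`,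
  -- the dynamical box `K' * r`, and 1 makes the inequality strict.
  set a := ‖P‖ * |K| + K' * r + 1 with ha
  have ha0 : 0 < a := by positivity
  have hsmall : ∀ᶠ n : ℕ in atTop, ρ ^ n * a < 1 / 8 ∧ ‖1 - P‖ * |K| * ρ ^ n < 1 / 8 := by
    have ht := tendsto_pow_atTop_nhds_zero_of_lt_one hρ0.le hρ1
    have h1 := ht.mul_const a
    have h2 := ht.const_mul (‖1 - P‖ * |K|)
    rw [zero_mul] at h1
    rw [mul_zero] at h2
    exact (h1.eventually (gt_mem_nhds (by norm_num))).and
      (h2.eventually (gt_mem_nhds (by norm_num)))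
  refine ⟨ENNReal.ofReal K * volume (box P a (1 / 4)) / c, ENNReal.div_ne_top
    (ENNReal.mul_ne_top ENNReal.ofReal_ne_top volume_box_lt_top.ne) hc0, ?_⟩
  filter_upwards [hsmall] with n hn S hS s hs
  refine le_mul_ofReal_div_pow (by positivity) hc0 hc1 ?_
  have hρn : 0 < ρ ^ n := by positivity
  -- Covering at the scale `ρⁿ` of the unstable width uses at most `K ρ^(-kn)` centres, each with a
  -- box of volume proportional to `ρ^(un)`.
  obtain ⟨t, ht, hSt⟩ := h𝒟 S hS (ρ ^ n) hρn (pow_le_one₀ hρ0.le hρ1.le)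
  set E := box P (ρ ^ n * a) (1 / 4) with hE
  have hEhalf : ∀ v ∈ E, ‖v‖ < 1 / 2 := fun v hv => by
    have := norm_lt_of_mem_box hv
    linarith [hn.1]
  refine (hc n S (⋃ y ∈ t, (fun v => y + toTorus v) '' E) s hs ?_).trans ?_
  · intro x hx v hv1 hv2
    obtain ⟨y, hy, hxy⟩ := hSt x hx
    obtain ⟨w, hw, hwn⟩ := exists_toTorus_eq (x - y)
    have hwK : ‖w‖ ≤ |K| * ρ ^ n := by
      rw [hwn, ← dist_eq_norm]
      exact hxy.trans (by gcongr; exact le_abs_self K)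
    refine mem_iUnion₂.2 ⟨y, hy, w + v, ⟨?_, ?_⟩, ?_⟩
    · have h1 : ‖P.mulVec v‖ ≤ K' * ρ ^ n * r := by
        have := h.norm_mulVec_le hK' 0 n v
        rw [pow_zero, one_mul, zero_add] at this
        exact this.trans (by gcongr)
      rw [Matrix.mulVec_add]
      calc _ ≤ ‖P.mulVec w‖ + ‖P.mulVec v‖ := norm_add_le _ _
        _ ≤ ‖P‖ * (|K| * ρ ^ n) + K' * ρ ^ n * r := by
          refine add_le_add ((Matrix.linfty_opNorm_mulVec _ _).trans ?_) h1
          gcongr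
        _ < ρ ^ n * a := by rw [ha]; nlinarith
    · rw [Matrix.mulVec_add]
      calc _ ≤ ‖(1 - P).mulVec w‖ + ‖(1 - P).mulVec v‖ := norm_add_le _ _
        _ < ‖1 - P‖ * (|K| * ρ ^ n) + r := by
          refine add_lt_add_of_le_of_lt ((Matrix.linfty_opNorm_mulVec _ _).trans ?_) hv2
          gcongr
        _ ≤ 1 / 4 := by nlinarith [hn.2]
    · change y + toTorus (w + v) = x + toTorus v
      rw [toTorus_add, hw]; abel
  · calc volume (⋃ y ∈ t, (fun v => y + toTorus v) '' E)
        ≤ ∑ y ∈ t, volume ((fun v => y + toTorus v) '' E) := measure_biUnion_finset_le _ _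
      _ = t.card * (ENNReal.ofReal ((ρ ^ n) ^ u) * volume (box P a (1 / 4))) := by
        simp only [volume_add_toTorus_image _ isOpen_box hEhalf, hE,
          volume_box_mul_left h.idem hBC hCB hρn, Finset.sum_const, nsmul_eq_mul]
      _ = ENNReal.ofReal (t.card * (ρ ^ n) ^ k) * volume (box P a (1 / 4)) *
          ENNReal.ofReal (ρ ^ (u - k)) ^ n := by
        rw [← ENNReal.ofReal_pow (by positivity), ← ENNReal.ofReal_natCast, ← mul_assoc,
          ← ENNReal.ofReal_mul (by positivity), mul_right_comm, ← ENNReal.ofReal_mul (by positivity)]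
        congr 2
        obtain ⟨m, rfl⟩ := Nat.exists_eq_add_of_lt hk
        rw [show k + m + 1 - k = m + 1 by omega]
        ring
      _ ≤ _ := by gcongr

/-- The entropy of a small disk in the unstable direction. -/
theorem le_coverEntropy_unstableDisk {u : ℕ} {B : Matrix (Fin d) (Fin u) ℝ}
    {C : Matrix (Fin u) (Fin d) ℝ} (hBC : P = B * C) (hCB : C * B = 1) {η : ℝ} (hη : 0 < η) :
    ENNReal.log (ENNReal.ofReal (unstableVolume (realMatrix A) P)) ≤
      coverEntropy (matrixMap A) ((fun t => toTorus (η • B.mulVec t)) '' cube u) := by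
  have hD := h.unstableVolume_pos
  set R := realMatrix A with hR
  set D := unstableVolume R P with hDdef
  have key (θ : ℝ) (hθ0 : 0 < θ) (hθ1 : θ < 1) :
      ENNReal.log (ENNReal.ofReal (θ ^ d / D⁻¹)) ≤
        coverEntropy (matrixMap A) ((fun t => toTorus (η • B.mulVec t)) '' cube u) := by
    set ε : ℝ := 1 / (4 * (‖R‖ + 1)) with hε
    have hε0 : 0 < ε := by positivity
    have hε1 : ‖R‖ * (2 * ε) ≤ 1 / 2 := by
      rw [hε]; field_simp; linarith
    have hε2 : 2 * ε ≤ 1 / 2 := by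
      rw [hε, mul_one_div, div_le_div_iff₀ (by positivity) (by norm_num)]
      linarith [norm_nonneg R]
    refine le_trans ?_ (coverEntropyEntourage_le_coverEntropy _ _ (Metric.dist_mem_uniformity hε0))
    obtain ⟨r, hr0, hr⟩ := h.exists_forall_norm_pow_mulVec_lt hθ0 hθ1 hε0
    -- `a ≤ r` controls the orbits of kernel components, `a ≤ 1 / 4` makes the projection injective
    -- on `N`, and `‖C‖ * a ≤ η` places the unstable components on the disk.
    set a := min (min r (1 / 4)) (η / (‖C‖ + 1)) with ha
    have ha0 : 0 < a := by positivity
    have har : a ≤ r := (min_le_left _ _).trans (min_le_left _ _)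
    have ha4 : a ≤ 1 / 4 := (min_le_left _ _).trans (min_le_right _ _)
    have haC : ‖C‖ * a ≤ η := by
      have : a ≤ η / (‖C‖ + 1) := min_le_right _ _
      rw [le_div_iff₀ (by positivity)] at this
      nlinarith
    -- Bounds both components of a vector whose orbit stays below `2 * ε` up to time `m = n - 1`;
    -- the factor `‖R * P‖` pays for the step from `m` to `n`.
    set c := (‖R * P‖ + ‖1 - P‖) * (2 * ε) + 1 with hc
    have hc0 : 0 < c := by positivity
    have hvc0 := (volume_box_pos (P := P) hc0 hc0).ne'
    have hvc1 := (volume_box_lt_top (P := P) (a := c) (b := c)).ne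
    rw [← ExpGrowth.expGrowthSup_pow]
    refine ExpGrowth.expGrowthSup_of_eventually_ge
      (b := volume (box P a a) / volume (box P c c))
      (ENNReal.div_ne_zero.2 ⟨(volume_box_pos ha0 ha0).ne', hvc1⟩) ?_
    -- A dynamical ball of length 0 imposes no condition, so lifting needs `n ≥ 1`.
    filter_upwards [eventually_ge_atTop 1] with n hn
    obtain ⟨m, rfl⟩ := Nat.exists_eq_add_of_le' hn
    rw [div_mul_ofReal_div_pow (by positivity) hvc0 hvc1, coverMincard, ENat.toENNReal_iInf]
    refine le_iInf fun s => ?_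
    rw [ENat.toENNReal_iInf]
    refine le_iInf fun hs => ENNReal.div_le_of_le_mul ?_
    set n := m + 1
    have hθn : 0 < θ ^ n := by positivity
    have hθn1 : θ ^ n ≤ 1 := pow_le_one₀ hθ0.le hθ1.le
    set N := box P (θ ^ n * a) (θ ^ n * a) with hN
    have hNhalf : ∀ v ∈ N, ‖v‖ < 1 / 2 := fun v hv => by
      have := norm_lt_of_mem_box hv
      nlinarith
    set E := (unstablePart R P ^ n).mulVec ⁻¹' box P c c ∩ Metric.ball 0 (1 / 2) with hE
    have hEopen : IsOpen E := isOpen_preimage_box.inter Metric.isOpen_ball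
    have hEhalf : ∀ v ∈ E, ‖v‖ < 1 / 2 := fun v hv => by simpa using hv.2
    -- The point `P v` of the disk is shadowed by some centre `x`, and `v` stays within `ε` of `P v`
    -- because its kernel component has size at most `θⁿ a`. So `v - x` stays below `2 * ε` and
    -- lifts.
    have hsub : toTorus '' N ⊆ ⋃ x ∈ s, (fun v => x + toTorus v) '' E := by
      rintro _ ⟨v, hv, rfl⟩
      have hCP : C.mulVec (P.mulVec v) = C.mulVec v := by
        rw [Matrix.mulVec_mulVec, hBC, ← Matrix.mul_assoc, hCB, Matrix.one_mul]
      have hCv : ‖C.mulVec v‖ ≤ η := by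
        rw [← hCP]
        refine (Matrix.linfty_opNorm_mulVec _ _).trans (le_trans ?_ haC)
        gcongr
        exact hv.1.le.trans (mul_le_of_le_one_left ha0.le hθn1)
      have hPv : toTorus (P.mulVec v) ∈ (fun t => toTorus (η • B.mulVec t)) '' cube u := by
        refine ⟨η⁻¹ • C.mulVec v, ?_, ?_⟩
        · have h1 (i : Fin u) : |η⁻¹ * C.mulVec v i| ≤ 1 := by
            rw [abs_mul, abs_of_pos (inv_pos.2 hη), inv_mul_le_iff₀ hη, mul_one]
            exact (norm_le_pi_norm _ i).trans hCv
          exact ⟨fun i => (abs_le.1 (h1 i)).1, fun i => (abs_le.1 (h1 i)).2⟩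
        · change toTorus _ = _
          rw [Matrix.mulVec_smul, smul_smul, mul_inv_cancel₀ hη.ne', one_smul,
            Matrix.mulVec_mulVec, ← hBC]
      obtain ⟨x, hx, hxv⟩ := hs hPv
      have hxv' := mem_dynEntourage_matrixMap.1 hxv
      have hQ : ∀ j ≤ n, ‖(R ^ j).mulVec ((1 - P).mulVec v)‖ < ε := by
        refine hr n _ ?_ ?_
        · rw [Matrix.mulVec_mulVec, mul_assoc, h.self_mul_compl]
          simpa using hr0
        · rw [Matrix.mulVec_mulVec, h.compl_idem, mul_comm]
          exact hv.2.trans_le (by gcongr)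
      obtain ⟨w, hw, hwn⟩ := exists_lift_of_forall_norm_lt (A := A) hε1 (n := m)
        (y := toTorus v - x) fun j hj => by
          have e : toTorus v - x = toTorus ((1 - P).mulVec v) - (x - toTorus (P.mulVec v)) := by
            rw [sub_sub_eq_add_sub, ← toTorus_add, ← Matrix.add_mulVec]; simp
          rw [e, matrixMap_sub, two_mul]
          refine (norm_sub_le _ _).trans_lt (add_lt_add ?_ (hxv' j hj))
          exact (norm_matrixMap_pow_toTorus_le _ _ _).trans_lt (hQ j hj.le)
      refine mem_iUnion₂.2 ⟨x, hx, w, ⟨h.mem_preimage_box.2 ⟨?_, ?_⟩, ?_⟩, ?_⟩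
      · have e : R ^ n * P = R * P * R ^ m := by
          rw [mul_assoc, h.mul_comm_pow, ← mul_assoc, ← pow_succ']
        rw [e, ← Matrix.mulVec_mulVec]
        refine (Matrix.linfty_opNorm_mulVec _ _).trans_lt ?_
        have h1 : ‖R * P‖ * ‖(R ^ m).mulVec w‖ ≤ ‖R * P‖ * (2 * ε) := by
          gcongr; exact (hwn m (by omega)).le
        have h2 : 0 ≤ ‖1 - P‖ * (2 * ε) := by positivity
        rw [hc]; linarith
      · refine (Matrix.linfty_opNorm_mulVec _ _).trans_lt ?_
        have h0 := hwn 0 (by omega)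
        rw [pow_zero, Matrix.one_mulVec] at h0
        have h1 : ‖1 - P‖ * ‖w‖ ≤ ‖1 - P‖ * (2 * ε) := by gcongr
        have h2 : 0 ≤ ‖R * P‖ * (2 * ε) := by positivity
        rw [hc]; linarith
      · have h0 := hwn 0 (by omega)
        rw [pow_zero, Matrix.one_mulVec] at h0
        simpa using h0.trans_le hε2
      · change x + toTorus w = toTorus v
        rw [hw]; abel
    calc volume (box P a a) * ENNReal.ofReal (θ ^ d) ^ n
        = volume (toTorus '' N) := by
          rw [volume_toTorus_image isOpen_box hNhalf, volume_box_smul hθn,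
            pow_right_comm θ n d, ENNReal.ofReal_pow (p := θ ^ d) (by positivity), mul_comm]
      _ ≤ ∑ x ∈ s, volume ((fun v => x + toTorus v) '' E) :=
          (measure_mono hsub).trans (measure_biUnion_finset_le _ _)
      _ = s.card * volume E := by
          simp only [volume_add_toTorus_image _ hEopen hEhalf, Finset.sum_const, nsmul_eq_mul]
      _ ≤ s.card * (ENNReal.ofReal D⁻¹ ^ n * volume (box P c c)) := by
          gcongr
          rw [← h.volume_preimage_box]
          exact measure_mono inter_subset_left
      _ = _ := by
          rw [mul_comm (volume (box P c c))]
          simp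
  have hev : ∀ᶠ θ : ℝ in 𝓝[<] 1, ENNReal.log (ENNReal.ofReal (θ ^ d / D⁻¹)) ≤
      coverEntropy (matrixMap A) ((fun t => toTorus (η • B.mulVec t)) '' cube u) := by
    filter_upwards [Ioo_mem_nhdsLT (zero_lt_one (α := ℝ))] with θ hθ using key θ hθ.1 hθ.2
  refine le_of_tendsto (Tendsto.mono_left ?_ nhdsWithin_le_nhds) hev
  have hc : ContinuousAt (fun θ : ℝ => ENNReal.log (ENNReal.ofReal (θ ^ d / D⁻¹))) 1 := by
    have : ContinuousAt (fun θ : ℝ => θ ^ d / D⁻¹) 1 := by fun_prop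
    exact ENNReal.continuous_log.continuousAt.comp
      (ENNReal.continuous_ofReal.continuousAt.comp this)
  simpa [ContinuousAt] using hc

end UnstableSplitting

variable {k : ℕ}

/-! ### Singular disks are Lipschitz -/

/-- A pointwise Lipschitz bound on a convex set is a Lipschitz bound. -/
theorem dist_le_of_eventually_dist_le {E X : Type*} [NormedAddCommGroup E] [NormedSpace ℝ E]
    [PseudoMetricSpace X] {φ : E → X} {s : Set E} (hs : Convex ℝ s) {K : ℝ}
    (h : ∀ t ∈ s, ∀ᶠ y in 𝓝 t, dist (φ y) (φ t) ≤ K * ‖y - t‖) {x y : E} (hx : x ∈ s)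
    (hy : y ∈ s) : dist (φ y) (φ x) ≤ (K + 1) * ‖y - x‖ := by
  rcases eq_or_ne y x with rfl | hne
  · simp
  have hM : 0 < ‖y - x‖ := norm_pos_iff.2 (sub_ne_zero.2 hne)
  set γ : ℝ → E := fun τ => x + τ • (y - x) with hγ
  have hγs : ∀ τ ∈ Icc (0 : ℝ) 1, γ τ ∈ s := fun τ hτ => hs.add_smul_sub_mem hx hy hτ
  have hγc : Continuous γ := by fun_prop
  have hγd (τ σ : ℝ) : ‖γ σ - γ τ‖ = |σ - τ| * ‖y - x‖ := by
    rw [← Real.norm_eq_abs, ← norm_smul, sub_smul]; congr 1; simp only [hγ]; abel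
  have hφc : ∀ t ∈ s, ContinuousAt φ t := fun t ht => by
    rw [ContinuousAt, tendsto_iff_dist_tendsto_zero]
    have h0 : Tendsto (fun y => K * ‖y - t‖) (𝓝 t) (𝓝 0) := by
      have : ContinuousAt (fun y => K * ‖y - t‖) t := by fun_prop
      simpa [ContinuousAt] using this
    exact squeeze_zero' (Eventually.of_forall fun _ => dist_nonneg) (h t ht) h0
  -- The comparison runs along the segment from `x` to `y` and requires a strictly larger slope for
  -- the barrier, hence `K + 1`.
  have key := image_le_of_liminf_slope_right_lt_deriv_boundary (a := 0) (b := 1)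
    (f := fun τ => dist (φ (γ τ)) (φ x)) (f' := fun _ => K * ‖y - x‖)
    (B := fun τ => (K + 1) * ‖y - x‖ * τ) (B' := fun _ => (K + 1) * ‖y - x‖) ?_ ?_ ?_ ?_ ?_
    (right_mem_Icc.2 zero_le_one)
  · simpa [hγ] using key
  · intro τ hτ
    refine ContinuousAt.continuousWithinAt ?_
    exact ((hφc _ (hγs τ hτ)).comp hγc.continuousAt).dist continuousAt_const
  · intro τ hτ r hr
    have hev : ∀ᶠ z in 𝓝[>] τ, dist (φ (γ z)) (φ (γ τ)) ≤ K * ‖γ z - γ τ‖ :=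
      (hγc.continuousAt.eventually (h _ (hγs τ (Ico_subset_Icc_self hτ)))).filter_mono
        nhdsWithin_le_nhds
    refine Eventually.frequently ?_
    filter_upwards [hev, self_mem_nhdsWithin] with z hz hzτ
    have hzτ' : 0 < z - τ := sub_pos.2 hzτ
    rw [slope_def_field, div_lt_iff₀ hzτ']
    rw [hγd, abs_of_pos hzτ'] at hz
    calc _ ≤ dist (φ (γ z)) (φ (γ τ)) := by
          linarith [dist_triangle (φ (γ z)) (φ (γ τ)) (φ x)]
      _ ≤ K * ‖y - x‖ * (z - τ) := by linarith
      _ < r * (z - τ) := by gcongr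
  · simp [hγ]
  · intro τ
    simpa using (hasDerivAt_id τ).const_mul ((K + 1) * ‖y - x‖)
  · intro τ _ _
    nlinarith

theorem convex_cube : Convex ℝ (cube k) := convex_Icc _ _

theorem isCompact_cube : IsCompact (cube k) := isCompact_Icc

theorem dist_toTorus_le (x y : Fin d → ℝ) : dist (toTorus x) (toTorus y) ≤ ‖x - y‖ := by
  rw [dist_eq_norm, ← toTorus_sub]; exact norm_toTorus_le _

/-- Local lifts are `C¹`, hence locally Lipschitz; compactness of the cube makes the pointwise
constant uniform, and convexity makes it global. -/
theorem IsDisk.exists_lipschitz {φ : (Fin k → ℝ) → Torus d} (hφ : IsDisk ⊤ φ) :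
    ∃ K, 0 ≤ K ∧ ∀ x ∈ cube k, ∀ y ∈ cube k, dist (φ y) (φ x) ≤ K * ‖y - x‖ := by
  suffices h : ∃ K, 0 ≤ K ∧ ∀ t ∈ cube k, ∀ᶠ y in 𝓝 t, dist (φ y) (φ t) ≤ K * ‖y - t‖ by
    obtain ⟨K, hK, h⟩ := h
    exact ⟨K + 1, by positivity, fun x hx y hy =>
      dist_le_of_eventually_dist_le convex_cube h hx hy⟩
  obtain ⟨U, -, hU, hg⟩ := hφ
  refine isCompact_cube.induction_on (p := fun S => ∃ K, 0 ≤ K ∧ ∀ t ∈ S, ∀ᶠ y in 𝓝 t,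
    dist (φ y) (φ t) ≤ K * ‖y - t‖) ⟨0, le_rfl, by simp⟩ ?_ ?_ ?_
  · rintro S T hST ⟨K, hK, h⟩
    exact ⟨K, hK, fun t ht => h t (hST ht)⟩
  · rintro S T ⟨K, hK, h⟩ ⟨K', hK', h'⟩
    refine ⟨max K K', hK.trans (le_max_left _ _), fun t ht => ?_⟩
    rcases ht with ht | ht
    · filter_upwards [h t ht] with y hy
      exact hy.trans (by gcongr; exact le_max_left _ _)
    · filter_upwards [h' t ht] with y hy
      exact hy.trans (by gcongr; exact le_max_right _ _)
  · intro t ht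
    obtain ⟨g, hgc, hgφ⟩ := hg t (hU ht)
    obtain ⟨K, W, hW, hL⟩ := (hgc.of_le (by simp)).exists_lipschitzOnWith
    obtain ⟨V, hV, hVo, htV⟩ := _root_.mem_nhds_iff.1 (inter_mem hW hgφ)
    refine ⟨V, mem_nhdsWithin_of_mem_nhds (hVo.mem_nhds htV), K, K.2, fun x hx => ?_⟩
    filter_upwards [hVo.mem_nhds hx] with y hy
    have e1 : φ y = toTorus (g y) := (hV hy).2
    have e2 : φ x = toTorus (g x) := (hV hx).2
    rw [e1, e2]
    refine (dist_toTorus_le _ _).trans ?_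
    rw [← dist_eq_norm, ← dist_eq_norm]
    exact hL.dist_le_mul _ (hV hy).1 _ (hV hx).1

/-- First-order partial derivatives bounded by 1 give a differential of norm at most `k`; one 1
absorbs the little-o error and the other comes from `dist_le_of_eventually_dist_le`. The constant is
the same for all disks, as the uniform entropy demands. -/
theorem SizeLE.lipschitz {φ : (Fin k → ℝ) → Torus d} (hφ : SizeLE ⊤ φ 1) :
    ∀ x ∈ cube k, ∀ y ∈ cube k, dist (φ y) (φ x) ≤ (k + 1 + 1) * ‖y - x‖ := by
  refine fun x hx y hy => dist_le_of_eventually_dist_le convex_cube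
    (fun t ht => ?_) hx hy
  obtain ⟨g, ⟨hgc, hgφ⟩, -, hsize⟩ := hφ t ht
  have hd : DifferentiableAt ℝ g t := hgc.differentiableAt (by simp)
  have hbound (w : Fin k → ℝ) : ‖fderiv ℝ g t w‖ ≤ k * ‖w‖ := by
    refine (pi_norm_le_iff_of_nonneg (by positivity)).2 fun j => ?_
    have h1 (i : Fin k) : |fderiv ℝ g t (Pi.single i 1) j| ≤ 1 := by
      have := hsize 1 le_top (fun _ => i) j
      rwa [iteratedFDeriv_one_apply] at this
    have hw : fderiv ℝ g t w j = ∑ i, w i * fderiv ℝ g t (Pi.single i 1) j := by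
      conv_lhs => rw [pi_eq_sum_univ' w, map_sum]
      simp
    rw [hw]
    calc _ ≤ ∑ i, ‖w i * fderiv ℝ g t (Pi.single i 1) j‖ := norm_sum_le _ _
      _ ≤ ∑ _i : Fin k, ‖w‖ := by
        refine Finset.sum_le_sum fun i _ => ?_
        rw [norm_mul]
        exact (mul_le_of_le_one_right (norm_nonneg _) (h1 i)).trans (norm_le_pi_norm w i)
      _ = k * ‖w‖ := by simp
  filter_upwards [hd.hasFDerivAt.isLittleO.def one_pos, hgφ] with s hs hsφ
  rw [hsφ, hgφ.eq_of_nhds]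
  refine (dist_toTorus_le _ _).trans ?_
  calc ‖g s - g t‖ = ‖g s - g t - fderiv ℝ g t (s - t) + fderiv ℝ g t (s - t)‖ := by
        rw [sub_add_cancel]
    _ ≤ 1 * ‖s - t‖ + k * ‖s - t‖ := (norm_add_le _ _).trans (add_le_add hs (hbound _))
    _ = _ := by ring

theorem hasCoverDim_image_cube {X : Type*} [PseudoMetricSpace X] {φ : (Fin k → ℝ) → X} {L : ℝ}
    (hL : 0 ≤ L) (h : ∀ x ∈ cube k, ∀ y ∈ cube k, dist (φ y) (φ x) ≤ L * ‖y - x‖) :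
    HasCoverDim (φ '' cube k) k (3 ^ k + 2 * L) := by
  classical
  intro δ hδ0 hδ1
  -- A grid of `(N + 1) ^ k` points with mesh `2 / N ≤ 2 δ`; since `δ ≤ 1`, `(N + 1) δ ≤ 3`.
  -- Rounding coordinates down keeps the grid point in the cube.
  set N := ⌈1 / δ⌉₊ with hN
  have hN1 : 1 / δ ≤ N := Nat.le_ceil _
  have hN2 : (N : ℝ) < 1 / δ + 1 := Nat.ceil_lt_add_one (by positivity)
  have hN0 : (0 : ℝ) < N := lt_of_lt_of_le (by positivity) hN1
  have hδN : 1 ≤ N * δ := (div_le_iff₀ hδ0).1 hN1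
  let p : (Fin k → Fin (N + 1)) → (Fin k → ℝ) := fun i j => -1 + 2 * ((i j : ℕ) : ℝ) / N
  refine ⟨Finset.univ.image fun i => φ (p i), ?_, ?_⟩
  · have hc : ((Finset.univ.image fun i => φ (p i)).card : ℝ) ≤ (N + 1 : ℝ) ^ k := by
      have : (Finset.univ.image fun i => φ (p i)).card ≤ (N + 1) ^ k :=
        Finset.card_image_le.trans (by simp)
      exact_mod_cast this
    have h3 : (N + 1) * δ ≤ 3 := by
      have : (N : ℝ) * δ ≤ (1 / δ + 1) * δ := by gcongr
      rw [add_mul, one_div, inv_mul_cancel₀ hδ0.ne'] at this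
      linarith
    calc _ ≤ (N + 1 : ℝ) ^ k * δ ^ k := by gcongr
      _ = ((N + 1) * δ) ^ k := by rw [mul_pow]
      _ ≤ 3 ^ k := by gcongr
      _ ≤ 3 ^ k + 2 * L := by linarith
  · rintro _ ⟨x, hx, rfl⟩
    have hx1 (j) : -1 ≤ x j := hx.1 j
    have hx2 (j) : x j ≤ 1 := hx.2 j
    have hnn (j) : 0 ≤ (x j + 1) * N / 2 := by
      have := hx1 j
      have : 0 ≤ x j + 1 := by linarith
      positivity
    let i : Fin k → Fin (N + 1) := fun j => ⟨⌊(x j + 1) * N / 2⌋₊, by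
      rw [Nat.lt_succ_iff]
      refine Nat.floor_le_of_le ?_
      have := hx2 j
      nlinarith⟩
    have hi1 (j) : ((i j : ℕ) : ℝ) ≤ (x j + 1) * N / 2 := Nat.floor_le (hnn j)
    have hi2 (j) : (x j + 1) * N / 2 < (i j : ℕ) + 1 := Nat.lt_floor_add_one _
    have hp1 (j) : p i j ≤ x j := by
      have : 2 * ((i j : ℕ) : ℝ) / N ≤ x j + 1 := by
        rw [div_le_iff₀ hN0]; linarith [hi1 j]
      simp only [p]; linarith
    have hp2 (j) : x j - p i j ≤ 2 * δ := by
      have : x j + 1 - 2 * δ ≤ 2 * ((i j : ℕ) : ℝ) / N := by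
        rw [le_div_iff₀ hN0]; nlinarith [hi2 j]
      simp only [p]; linarith
    have hp3 (j) : -1 ≤ p i j := by
      have : 0 ≤ 2 * ((i j : ℕ) : ℝ) / N := by positivity
      simp only [p]; linarith
    refine ⟨φ (p i), Finset.mem_image_of_mem _ (Finset.mem_univ i), ?_⟩
    refine (h (p i) ⟨hp3, fun j => (hp1 j).trans (hx2 j)⟩ x hx).trans ?_
    have : ‖x - p i‖ ≤ 2 * δ := by
      refine (pi_norm_le_iff_of_nonneg (by positivity)).2 fun j => ?_
      rw [Pi.sub_apply, Real.norm_eq_abs, abs_of_nonneg (sub_nonneg.2 (hp1 j))]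
      exact hp2 j
    have h3 : (0 : ℝ) ≤ 3 ^ k * δ := by positivity
    calc L * ‖x - p i‖ ≤ L * (2 * δ) := by gcongr
      _ ≤ (3 ^ k + 2 * L) * δ := by linarith

theorem exists_hasCoverDim_of_mem_diskFamily {S : Set (Torus d)} (hS : S ∈ diskFamily d k ⊤) :
    ∃ K, HasCoverDim S k K := by
  obtain ⟨φ, hφ, rfl⟩ := hS
  obtain ⟨L, hL, h⟩ := hφ.exists_lipschitz
  exact ⟨_, hasCoverDim_image_cube hL h⟩

theorem hasCoverDim_of_mem_uniformDiskFamily {S : Set (Torus d)}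
    (hS : S ∈ uniformDiskFamily d k ⊤) : HasCoverDim S k (3 ^ k + 2 * (k + 1 + 1)) := by
  obtain ⟨φ, -, hφ, rfl⟩ := hS
  exact hasCoverDim_image_cube (by positivity) hφ.lipschitz

/-! ### Linear disks -/

theorem exists_linear_disk {u : ℕ} (B : Matrix (Fin d) (Fin u) ℝ) :
    ∃ η : ℝ, 0 < η ∧ (fun t => toTorus (η • B.mulVec t)) '' cube u ∈ uniformDiskFamily d u ⊤ := by
  -- Makes the linear lift `1/4`-Lipschitz, so on the cube its values lie in the chart and its
  -- derivatives of order 0 and 1 are small; the higher ones vanish.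
  set η : ℝ := 1 / (4 * (‖B‖ + 1)) with hη
  have hη0 : 0 < η := by positivity
  have hηB : η * ‖B‖ ≤ 1 / 4 := by
    rw [hη]; field_simp; linarith
  set g : (Fin u → ℝ) →L[ℝ] (Fin d → ℝ) := η • LinearMap.toContinuousLinearMap (Matrix.toLin' B)
  have hg (t) : g t = η • B.mulVec t := by simp [g]
  have hgn (t) : ‖g t‖ ≤ 1 / 4 * ‖t‖ := by
    rw [hg, norm_smul, Real.norm_of_nonneg hη0.le]
    calc _ ≤ η * (‖B‖ * ‖t‖) := by gcongr; exact Matrix.linfty_opNorm_mulVec _ _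
      _ = η * ‖B‖ * ‖t‖ := by ring
      _ ≤ _ := by gcongr
  have hlift (t) : IsLocalLift ⊤ (fun t => toTorus (η • B.mulVec t)) t g :=
    ⟨g.contDiff.contDiffAt, Eventually.of_forall fun s => by
      change toTorus _ = toTorus _
      rw [hg]⟩
  have hcube {t} (ht : t ∈ cube u) : ‖t‖ ≤ 1 :=
    (pi_norm_le_iff_of_nonneg zero_le_one).2 fun i => abs_le.2 ⟨ht.1 i, ht.2 i⟩
  refine ⟨η, hη0, _, ⟨univ, isOpen_univ, subset_univ _, fun t _ => ⟨g, hlift t⟩⟩, fun t ht =>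
    ⟨g, hlift t, fun j => ?_, fun m _ v j => ?_⟩, rfl⟩
  · have h1 := (norm_le_pi_norm (g t) j).trans (hgn t)
    have h2 := hcube ht
    have h3 : |g t j| ≤ 1 / 4 := h1.trans (by linarith)
    rw [abs_le] at h3
    exact ⟨by linarith [h3.1], by linarith [h3.2]⟩
  · match m with
    | 0 =>
      rw [iteratedFDeriv_zero_apply]
      exact (norm_le_pi_norm (g t) j).trans ((hgn t).trans (by linarith [hcube ht]))
    | 1 =>
      rw [iteratedFDeriv_one_apply, g.fderiv]
      refine (norm_le_pi_norm (g _) j).trans ((hgn _).trans ?_)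
      rw [Pi.norm_single]; norm_num
    | m + 2 =>
      have : (fun y => fderiv ℝ g y) = fun _ => g := funext fun y => g.fderiv
      rw [iteratedFDeriv_succ_apply_right, this, iteratedFDeriv_succ_const]
      simp

/-! ### Comparison with the topological entropy -/

/-- Reversing time: `f^[n - 1]` sends a dynamical ball of `f` of length `n` to one of the inverse,
so it carries covers to covers. -/
theorem coverMincard_symm_le {X : Type*} [TopologicalSpace X] (f : X ≃ₜ X) (V : SetRel X X)
    (n : ℕ) : coverMincard f.symm univ V n ≤ coverMincard f univ V n := by
  classical
  refine le_iInf₂ fun s hs => ?_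
  have hcov : IsDynCoverOf f.symm univ V n (s.image f^[n - 1] : Finset X) := by
    intro x _
    obtain ⟨z, hz, hxz⟩ := hs (mem_univ (f.symm^[n - 1] x))
    refine ⟨f^[n - 1] z, by simpa using ⟨z, hz, rfl⟩, mem_dynEntourage.2 fun i hi => ?_⟩
    have h := mem_dynEntourage.1 hxz (n - 1 - i) (by omega)
    have e (y : X) : f.symm^[i] (f^[n - 1] y) = f^[n - 1 - i] y := by
      conv_lhs => rw [← Nat.add_sub_cancel' (show i ≤ n - 1 by omega), Function.iterate_add_apply]
      exact Function.LeftInverse.iterate f.symm_apply_apply i _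
    have e' : f^[n - 1 - i] (f.symm^[n - 1] x) = f.symm^[i] x := by
      have hr : Function.RightInverse f.symm f := f.apply_symm_apply
      rw [← e, hr.iterate (n - 1) x]
    rwa [e', ← e] at h
  exact hcov.coverMincard_le_card.trans (by exact_mod_cast Finset.card_image_le)

theorem topEntropy_symm {X : Type*} [UniformSpace X] (f : X ≃ₜ X) :
    topEntropy f.symm = topEntropy f := by
  have h (V : SetRel X X) (n : ℕ) : coverMincard f.symm univ V n = coverMincard f univ V n :=
    (coverMincard_symm_le f V n).antisymm (coverMincard_symm_le f.symm V n)
  simp [topEntropy, coverEntropy, coverEntropyEntourage, h]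

theorem familyEntropy_le_topEntropy {X : Type*} [UniformSpace X] (f : X → X) (𝒟 : Set (Set X)) :
    familyEntropy f 𝒟 ≤ topEntropy f :=
  iSup₂_le fun S _ => coverEntropy_monotone f (subset_univ S)

theorem uniformFamilyEntropy_le_topEntropy {X : Type*} [UniformSpace X] (f : X → X)
    (𝒟 : Set (Set X)) : uniformFamilyEntropy f 𝒟 ≤ topEntropy f := by
  rw [topEntropy, coverEntropy_eq_uniformFamilyEntropy]
  refine iSup₂_mono fun V _ => ExpGrowth.expGrowthSup_monotone fun n => iSup₂_le fun S _ => ?_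
  simpa using coverMincard_monotone_subset f V n (subset_univ S)

theorem coverEntropy_le_uniformFamilyEntropy {X : Type*} [UniformSpace X] (f : X → X)
    {𝒟 : Set (Set X)} {S : Set X} (hS : S ∈ 𝒟) : coverEntropy f S ≤ uniformFamilyEntropy f 𝒟 :=
  iSup₂_mono fun V _ => ExpGrowth.expGrowthSup_monotone fun n =>
    le_iSup₂ (f := fun D (_ : D ∈ 𝒟) => ((coverMincard f D V n : ℕ∞) : ENNReal)) S hS

/-! ### The unstable dimension of a torus automorphism -/

namespace UnstableSplitting

variable {A : Matrix (Fin d) (Fin d) ℤ} {R' P : Matrix (Fin d) (Fin d) ℝ} {u : ℕ}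
  {B : Matrix (Fin d) (Fin u) ℝ} {C : Matrix (Fin u) (Fin d) ℝ}
  (h : UnstableSplitting (realMatrix A) R' P) (hBC : P = B * C) (hCB : C * B = 1)
include h hBC hCB

theorem topEntropy_eq :
    topEntropy (matrixMap A) = ENNReal.log (ENNReal.ofReal (unstableVolume (realMatrix A) P)) :=
  h.topEntropy_le.antisymm <| (h.le_coverEntropy_unstableDisk hBC hCB one_pos).trans
    (coverEntropy_monotone _ (subset_univ _))

theorem dimEntropy_eq : dimEntropy u (matrixMap A) = topEntropy (matrixMap A) := by
  refine (familyEntropy_le_topEntropy _ _).antisymm ?_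
  obtain ⟨η, hη, φ, hφ, -, hS⟩ := exists_linear_disk B
  rw [h.topEntropy_eq hBC hCB]
  exact (h.le_coverEntropy_unstableDisk hBC hCB hη).trans
    (le_iSup₂ (f := fun S (_ : S ∈ diskFamily d u ⊤) => coverEntropy (matrixMap A) S) _ ⟨φ, hφ, hS⟩)

theorem uniformDimEntropy_eq : uniformDimEntropy u (matrixMap A) = topEntropy (matrixMap A) := by
  refine (uniformFamilyEntropy_le_topEntropy _ _).antisymm ?_
  obtain ⟨η, hη, hS⟩ := exists_linear_disk B
  rw [h.topEntropy_eq hBC hCB]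
  exact (h.le_coverEntropy_unstableDisk hBC hCB hη).trans
    (coverEntropy_le_uniformFamilyEntropy _ hS)

/-- Each disk has its own covering constant, but the bound `e < h_top` is common to all, so the
supremum stays below it. -/
theorem dimEntropy_ne {k : ℕ} (hk : k < u) :
    dimEntropy k (matrixMap A) ≠ topEntropy (matrixMap A) := by
  obtain ⟨e, he, hle⟩ := h.uniformFamilyEntropy_lt hBC hCB hk
  rw [h.topEntropy_eq hBC hCB]
  refine (lt_of_le_of_lt (iSup₂_le fun S hS => ?_) he).ne
  obtain ⟨K, hK⟩ := exists_hasCoverDim_of_mem_diskFamily hS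
  rw [coverEntropy_eq_uniformFamilyEntropy]
  exact hle K {S} (by simpa using hK)

theorem uniformDimEntropy_ne {k : ℕ} (hk : k < u) :
    uniformDimEntropy k (matrixMap A) ≠ topEntropy (matrixMap A) := by
  obtain ⟨e, he, hle⟩ := h.uniformFamilyEntropy_lt hBC hCB hk
  rw [h.topEntropy_eq hBC hCB]
  exact ((hle _ _ fun S hS => hasCoverDim_of_mem_uniformDiskFamily hS).trans_lt he).ne

theorem isUnstableDim_iff (hu : u ≤ d) (v : ℕ) : IsUnstableDim (matrixMap A) v ↔ v = u := by
  have hleast : IsUnstableDim (matrixMap A) u :=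
    ⟨⟨hu, h.uniformDimEntropy_eq hBC hCB⟩, fun k hk =>
      not_lt.1 fun hlt => h.uniformDimEntropy_ne hBC hCB hlt hk.2⟩
  exact ⟨fun hv => hv.unique hleast, fun hv => hv ▸ hleast⟩

theorem dimEntropy_eq_and_forall_ne_iff (v : ℕ) :
    (dimEntropy v (matrixMap A) = topEntropy (matrixMap A) ∧
      ∀ k < v, dimEntropy k (matrixMap A) ≠ topEntropy (matrixMap A)) ↔ v = u := by
  constructor
  · rintro ⟨h1, h2⟩
    exact le_antisymm (not_lt.1 fun hlt => h2 u hlt (h.dimEntropy_eq hBC hCB))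
      (not_lt.1 fun hlt => h.dimEntropy_ne hBC hCB hlt h1)
  · rintro rfl
    exact ⟨h.dimEntropy_eq hBC hCB, fun k hk => h.dimEntropy_ne hBC hCB hk⟩

end UnstableSplitting

/-! ### Unstable, stable and central dimensions. -/

theorem isHyperbolic_iff (A : Matrix.GeneralLinearGroup (Fin d) ℤ) :
    IsHyperbolic A ↔ ∀ z ∈ (complexCharpoly (realMatrix A.val)).roots, ‖z‖ ≠ 1 := by
  have hchar : (A.val.map (Int.cast : ℤ → ℂ)).charpoly = complexCharpoly (realMatrix A.val) := by
    rw [complexCharpoly, ← Matrix.charpoly_map]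
    rfl
  refine forall_congr' fun z => imp_congr_left ?_
  rw [Module.End.hasEigenvalue_iff_isRoot_charpoly, Matrix.charpoly_toLin', hchar,
    Polynomial.mem_roots ((Matrix.charpoly_monic _).map _).ne_zero]

/-- The matrix `1 - P - P'` is a projection too, of some rank `c`, and traces give `u + s + c = d`.
So `u + s = d` exactly when this central projection vanishes. -/
theorem exists_unstable_stable_dim (A : Matrix.GeneralLinearGroup (Fin d) ℤ) :
    ∃ u s : ℕ, u ≤ d ∧ s ≤ d ∧ (u + s = d ↔ IsHyperbolic A) ∧
      (∃ (P : Matrix (Fin d) (Fin d) ℝ) (B : Matrix (Fin d) (Fin u) ℝ)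
        (C : Matrix (Fin u) (Fin d) ℝ), UnstableSplitting (realMatrix A.val)
          (realMatrix A⁻¹.val) P ∧ P = B * C ∧ C * B = 1) ∧
      (∃ (P : Matrix (Fin d) (Fin d) ℝ) (B : Matrix (Fin d) (Fin s) ℝ)
        (C : Matrix (Fin s) (Fin d) ℝ), UnstableSplitting (realMatrix A⁻¹.val)
          (realMatrix A.val) P ∧ P = B * C ∧ C * B = 1) := by
  have hA : realMatrix A⁻¹.val * realMatrix A.val = 1 := by
    rw [← map_mul, ← Units.val_mul, inv_mul_cancel, Units.val_one, map_one]
  obtain ⟨P, P', h, h', hiff⟩ := exists_unstableSplittings hA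
  obtain ⟨u, B, C, hBC, hCB⟩ := exists_rank_factorization h.idem
  obtain ⟨s, B', C', hBC', hCB'⟩ := exists_rank_factorization h'.idem
  have hcentral : (1 - P - P') * (1 - P - P') = 1 - P - P' := by
    simp only [sub_mul, mul_sub, one_mul, mul_one, h.idem, h'.idem, h.mul_eq_zero h',
      h'.mul_eq_zero h]
    abel
  obtain ⟨c, B₀, C₀, hBC₀, hCB₀⟩ := exists_rank_factorization hcentral
  have htrace : u + s + c = d := by
    have e : (1 : Matrix (Fin d) (Fin d) ℝ) = P + P' + (1 - P - P') := by abel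
    have := congrArg Matrix.trace e
    rw [Matrix.trace_add, Matrix.trace_add, hBC₀, trace_mul_of_mul_eq_one hCB₀, hBC, hBC',
      trace_mul_of_mul_eq_one hCB, trace_mul_of_mul_eq_one hCB', Matrix.trace_one,
      Fintype.card_fin] at this
    exact_mod_cast this.symm
  refine ⟨u, s, by omega, by omega, ?_, ⟨P, B, C, h, hBC, hCB⟩, ⟨P', B', C', h', hBC', hCB'⟩⟩
  rw [isHyperbolic_iff, ← hiff]
  constructor
  · intro hus
    obtain rfl : c = 0 := by omega
    rw [hBC₀]
    ext i j
    simp [Matrix.mul_apply]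
  · intro h0
    have := trace_mul_of_mul_eq_one hCB₀
    rw [← hBC₀, h0, Matrix.trace_zero] at this
    have : c = 0 := by exact_mod_cast this.symm
    omega

end DimEntropy

end

theorem mainTheorem7 (d : ℕ) (A : Matrix.GeneralLinearGroup (Fin d) ℤ) :
    (DimEntropy.EntropyHyperbolic (DimEntropy.linearAut A) ↔ DimEntropy.IsHyperbolic A) ∧
      (DimEntropy.EntropyHyperbolic' (DimEntropy.linearAut A) ↔ DimEntropy.IsHyperbolic A) := by
  obtain ⟨u, s, hu, hs, hiff, ⟨P, B, C, h, hBC, hCB⟩, ⟨P', B', C', h', hBC', hCB'⟩⟩ :=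
    DimEntropy.exists_unstable_stable_dim A
  have hf : ⇑(DimEntropy.linearAut A) = DimEntropy.matrixMap A.val := rfl
  have hf' : ⇑(DimEntropy.linearAut A).symm = DimEntropy.matrixMap A⁻¹.val := rfl
  rw [← hiff]
  constructor
  · simp only [DimEntropy.EntropyHyperbolic, hf, hf', h.isUnstableDim_iff hBC hCB hu,
      h'.isUnstableDim_iff hBC' hCB' hs]
    exact ⟨by rintro ⟨_, _, rfl, rfl, h⟩; exact h, fun h => ⟨u, s, rfl, rfl, h⟩⟩
  -- Here the entropies of the inverse are compared with `h_top(f)`, so invariance of entropy under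
  -- inversion is required.
  · have htop : DimEntropy.topEntropy (DimEntropy.matrixMap A.val) =
        DimEntropy.topEntropy (DimEntropy.matrixMap A⁻¹.val) :=
      (DimEntropy.topEntropy_symm (DimEntropy.linearAut A)).symm
    simp only [DimEntropy.EntropyHyperbolic', hf, hf',
      h.dimEntropy_eq_and_forall_ne_iff hBC hCB]
    simp only [htop, h'.dimEntropy_eq_and_forall_ne_iff hBC' hCB']
    exact ⟨by rintro ⟨_, _, rfl, rfl, h⟩; exact h, fun h => ⟨u, s, rfl, rfl, h⟩⟩
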